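/- Let $d\ge 2$, let $\mathbb K=\mathbb R$ or $\mathbb C$, and let $\mathbb X$ be the symmetric space of $\mathrm{SL}(d,\mathbb K)$, i.e. the set of positive definite Hermitian $d\times d$ matrices over $\mathbb K$ of determinant $1$, with the action $g.x=gxg^\dagger$ and the Riemannian metric $\langle v,w\rangle_p=\frac12\mathrm{Tr}(p^{-1}vp^{-1}w)$. Let $d(\cdot,\cdot)$ be its Riemannian distance and $I$ the identity matrix. For $p,q\in\mathbb X$ there is a unique real diagonal trace-zero matrix $A=\mathrm{Diag}(a_1\ge a_2\ge\dots\ge a_d)$ such that $p=g.I$ and $q=g\exp(A).I$ for some $g\in\mathrm{SL}(d,\mathbb K)$; put $d_\alpha(p,q)=\alpha(A)=a_1-a_2$. Let $Z=\frac{1}{\sqrt{2d(d-1)}}\mathrm{Diag}(d-1,-1,\dots,-1)$. The visual boundary of $\mathbb X$ is the set of unit-speed geodesic rays up to bounded distance. Its Weyl chambers are the sets $\{[t\mapsto g\exp(tA).I] : A=\mathrm{Diag}(a_1\ge\dots\ge a_d),\ \mathrm{Tr}A=0,\ 2\mathrm{Tr}(A^2)=1\}$ with $g\in \mathrm{SL}(d,\mathbb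 K)$, and its points of type $\zeta$ are the points $[t\mapsto g\exp(tZ).I]$ with $g\in \mathrm{SL}(d,\mathbb K)$. For $o,x\in\mathbb X$ with $d_\alpha(o,x)>0$, let $\zeta(ox)$ be the ideal point of type $\zeta$ lying in a common Weyl chamber with the endpoint of the geodesic ray from $o$ through $x$. For ideal points $\xi,\eta$ let $\measuredangle_o(\xi,\eta)$ be the Riemannian angle at $o$ between the rays from $o$ to $\xi$ and to $\eta$. An ideal point is identified with the unit vector in $T_o\mathbb X$ pointing to it; under this identification the points of type $\zeta$ form an orbit of the stabilizer $K$ of $o$ in the unit sphere of $T_o\mathbb X$, denoted $K\cdot Z$ (for $o=I$ it is $\{2kZk^\dagger : k\in K\}$). **Lemma ($\zeta$-angle estimate).** Let $o\in\mathbb X$. The map $x\mapsto\zeta(ox)$ is well defined and smooth from $\{x\in\mathbb X: d_\alpha(o,x)>0\}$ to $K\cdot Z\subset T_o\mathbb X$. Moreover, if $S>D\ge 0$ and $x,y\in\mathbb X$ satisfy $d_\alpha(o,x)\ge S$ and $d(x,y)\le D$, then $d_\alpha(o,y)>0$ and $$\measuredangle_o(\zeta(ox),\zeta(oy))\le\frac{\alpha(Z)}{\sinh(S-D)}\,d(x,y).$$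 -/

import Mathlib

open scoped ComplexOrder Matrix Matrix.Norms.Frobenius ContDiff

noncomputable section

namespace SLSym

/-- `d × d` matrices over `𝕜`, which is `ℝ` or `ℂ`.  They carry the Frobenius norm, which is used
only to speak of derivatives and smoothness. -/
abbrev Mat (d : ℕ) (𝕜 : Type*) := Matrix (Fin d) (Fin d) 𝕜

variable {d : ℕ} {𝕜 : Type*} [RCLike 𝕜]

/-! ### The symmetric space and its Riemannian metric -/

variable (d 𝕜) in
/-- The symmetric space of `SL(d, 𝕜)`: positive definite Hermitian matrices of determinant one. -/
def SymSpace : Set (Mat d 𝕜) := {x | x.PosDef ∧ x.det = 1}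

/-- The action `g.x = g x g†`. -/
def act (g x : Mat d 𝕜) : Mat d 𝕜 := g * x * gᴴ

/-- The Riemannian metric `⟨v, w⟩_p = (1/2) Tr (p⁻¹ v p⁻¹ w)` (a real number for Hermitian
`v`, `w`). -/
def metric (p v w : Mat d 𝕜) : ℝ := (1 / 2) * RCLike.re (p⁻¹ * v * p⁻¹ * w).trace

/-- The Riemannian length of a curve on `[0, 1]`. -/
def curveLength (γ : ℝ → Mat d 𝕜) : ℝ :=
  ∫ t in (0 : ℝ)..1, Real.sqrt (metric (γ t) (deriv γ t) (deriv γ t))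

/-- The Riemannian distance: the infimum of the lengths of the `C¹` curves in the symmetric space
from `x` to `y`. (The curve is parametrized by `[0, 1]`; outside of that interval it is merely
a `C¹` curve of matrices.) -/
def rdist (x y : Mat d 𝕜) : ℝ :=
  sInf {L | ∃ γ : ℝ → Mat d 𝕜, ContDiff ℝ 1 γ ∧ (∀ t ∈ Set.Icc (0 : ℝ) 1, γ t ∈ SymSpace d 𝕜) ∧
    γ 0 = x ∧ γ 1 = y ∧ L = curveLength γ}

/-! ### The Weyl chamber, vector-valued distance and root pseudodistance -/

variable (d) in
/-- The closed Weyl chamber `𝔞⁺`: real diagonal matrices of trace zero with non-increasing entries,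
each written as the vector of its diagonal entries. -/
def weylChamber : Set (Fin d → ℝ) := {a | Antitone a ∧ ∑ i, a i = 0}

/-- The first simple root `α (a) = a₁ - a₂`. -/
def alpha [d.AtLeastTwo] (a : Fin d → ℝ) : ℝ := a 0 - a 1

variable (d) in
/-- `Z = (2d(d-1))^(-1/2) diag (d-1, -1, …, -1)`. -/
def Zvec : Fin d → ℝ := fun i =>
  (if i.val = 0 then (d : ℝ) - 1 else -1) / Real.sqrt (2 * d * (d - 1))

/-- The real diagonal matrix with entries `a`. -/
def diagMat (a : Fin d → ℝ) : Mat d 𝕜 := Matrix.diagonal fun i => (a i : 𝕜)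

/-- `exp (A)` for the real diagonal matrix `A` with entries `a`. -/
def expDiag (a : Fin d → ℝ) : Mat d 𝕜 := diagMat fun i => Real.exp (a i)

/-- `a ∈ 𝔞⁺` is the vector-valued distance from `p` to `q`: for some `g` in `SL(d, 𝕜)`,
`p = g.I` and `q = g exp (A).I`. -/
def IsVecDist (p q : Mat d 𝕜) (a : Fin d → ℝ) : Prop :=
  a ∈ weylChamber d ∧ ∃ g : Matrix.SpecialLinearGroup (Fin d) 𝕜,
    act g.1 1 = p ∧ act (g.1 * expDiag a) 1 = q

/-- The vector-valued distance. -/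
def vecDist (p q : Mat d 𝕜) : Fin d → ℝ := Classical.epsilon (IsVecDist p q)

/-- The root pseudodistance `d_α`. -/
def dAlpha [d.AtLeastTwo] (p q : Mat d 𝕜) : ℝ := alpha (vecDist p q)

/-! ### Geodesic rays and the visual boundary -/

/-- Unit-speed geodesics of the symmetric space. The Levi-Civita connection of the metric is
`∇_v W = D_v W - (1/2) (v p⁻¹ W + W p⁻¹ v)`, so that the geodesic equation reads
`c'' = c' c⁻¹ c'`. -/
structure IsUnitGeodesic (c : ℝ → Mat d 𝕜) : Prop where
  smooth : ContDiff ℝ ∞ c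
  mem : ∀ t, c t ∈ SymSpace d 𝕜
  geodesic : ∀ t, deriv (deriv c) t = deriv c t * (c t)⁻¹ * deriv c t
  unit : ∀ t, metric (c t) (deriv c t) (deriv c t) = 1

variable (d 𝕜) in
/-- Unit-speed geodesic rays. By completeness of the symmetric space each ray is the
restriction to `[0, ∞)` of a unique geodesic defined on `ℝ`, by which it is represented. -/
def Ray := {c : ℝ → Mat d 𝕜 // IsUnitGeodesic c}

/-- Two rays are asymptotic if they stay at bounded distance from each other. -/
def Asymptotic (c c' : Ray d 𝕜) : Prop := ∃ C : ℝ, ∀ t : ℝ, 0 ≤ t → rdist (c.1 t) (c'.1 t) ≤ C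

variable (d 𝕜) in
/-- The visual boundary: rays up to asymptotic equivalence. -/
def Boundary := Quot (Asymptotic (d := d) (𝕜 := 𝕜))

/-- The ideal endpoint of a ray. -/
def Ray.endpoint (c : Ray d 𝕜) : Boundary d 𝕜 := Quot.mk _ c

/-- The curve `g.c_A(t) = g exp (tA).I`. -/
def stdCurve (g : Matrix.SpecialLinearGroup (Fin d) 𝕜) (a : Fin d → ℝ) (t : ℝ) : Mat d 𝕜 :=
  act (g.1 * expDiag fun i => t * a i) 1

variable (d) in
/-- The model spherical Weyl chamber: unit vectors in `𝔞⁺`, for the inner product `2 Tr (AB)`. -/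
def sigmaMod : Set (Fin d → ℝ) := {a | a ∈ weylChamber d ∧ 2 * ∑ i, a i ^ 2 = 1}

theorem stdCurve_eq (g : Matrix.SpecialLinearGroup (Fin d) 𝕜) (a : Fin d → ℝ) (t : ℝ) :
    stdCurve g a t = g.1 * diagMat (fun i => Real.exp (2 * a i * t)) * g.1ᴴ := by
  have h : (expDiag (fun i => t * a i) : Mat d 𝕜) * (expDiag (fun i => t * a i) : Mat d 𝕜)ᴴ
      = diagMat (fun i => Real.exp (2 * a i * t)) := by
    simp only [expDiag, diagMat, Matrix.diagonal_conjTranspose, Matrix.diagonal_mul_diagonal]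
    congr 1
    funext i
    simp only [Pi.star_apply, RCLike.star_def, RCLike.conj_ofReal, ← RCLike.ofReal_mul,
      ← Real.exp_add]
    congr 2
    ring
  rw [stdCurve, act, mul_one, Matrix.conjTranspose_mul, ← h]
  simp only [Matrix.mul_assoc]

/-- The linear map `v ↦ g diag (v) g†`. -/
def sandwich (g : Mat d 𝕜) : (Fin d → ℝ) →L[ℝ] Mat d 𝕜 :=
  LinearMap.toContinuousLinearMap
    { toFun := fun v => g * diagMat v * gᴴ
      map_add' := fun v w => by
        have : (diagMat (v + w) : Mat d 𝕜) = diagMat v + diagMat w := by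
          simp [diagMat, Matrix.diagonal_add]
        rw [this, mul_add, add_mul]
      map_smul' := fun r v => by
        have : (diagMat (r • v) : Mat d 𝕜) = r • diagMat v := by
          ext i j
          by_cases h : i = j <;> simp [diagMat, h, RCLike.real_smul_eq_coe_mul]
        rw [this]
        simp }

theorem sandwich_apply (g : Mat d 𝕜) (v : Fin d → ℝ) : sandwich g v = g * diagMat v * gᴴ := rfl

theorem stdCurve_isUnitGeodesic (g : Matrix.SpecialLinearGroup (Fin d) 𝕜) {a : Fin d → ℝ}
    (ha : a ∈ sigmaMod d) : IsUnitGeodesic (stdCurve g a) := by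
  obtain ⟨⟨-, hsum⟩, hunit⟩ := ha
  have hc : stdCurve g a = fun t => sandwich g.1 (fun i => Real.exp (2 * a i * t)) := by
    funext t; rw [stdCurve_eq, sandwich_apply]
  have hE : ∀ (i : Fin d) (t : ℝ),
      HasDerivAt (fun t => Real.exp (2 * a i * t)) (2 * a i * Real.exp (2 * a i * t)) t := by
    intro i t
    have := ((hasDerivAt_id t).const_mul (2 * a i)).exp
    simpa [mul_comm] using this
  have hd1 : deriv (stdCurve g a)
      = fun t => sandwich g.1 (fun i => 2 * a i * Real.exp (2 * a i * t)) := by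
    funext t
    rw [hc]
    exact ((sandwich g.1).hasFDerivAt.comp_hasDerivAt t
      (hasDerivAt_pi.2 fun i => hE i t)).deriv
  have hd2 : ∀ t, deriv (deriv (stdCurve g a)) t
      = sandwich g.1 (fun i => 2 * a i * (2 * a i * Real.exp (2 * a i * t))) := by
    intro t
    rw [hd1]
    exact ((sandwich g.1).hasFDerivAt.comp_hasDerivAt t
      (hasDerivAt_pi.2 fun i => (hE i t).const_mul (2 * a i))).deriv
  have hg : IsUnit g.1.det := by rw [g.2]; exact isUnit_one
  have hgH : IsUnit (g.1ᴴ).det := by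
    rw [Matrix.det_conjTranspose, g.2]; simp
  have hmul : ∀ v w : Fin d → ℝ, (diagMat v : Mat d 𝕜) * diagMat w = diagMat (v * w) := by
    intro v w; simp [diagMat, Matrix.diagonal_mul_diagonal]
  have hinv : ∀ t, (stdCurve g a t)⁻¹
      = (g.1ᴴ)⁻¹ * diagMat (fun i => Real.exp (-(2 * a i * t))) * (g.1)⁻¹ := by
    intro t
    have h1 : (diagMat (fun i => Real.exp (2 * a i * t)) : Mat d 𝕜)
        * diagMat (fun i => Real.exp (-(2 * a i * t))) = 1 := by
      rw [hmul]
      simp only [diagMat, Pi.mul_apply, ← Real.exp_add, add_neg_cancel, Real.exp_zero,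
        RCLike.ofReal_one, Matrix.diagonal_one]
    rw [stdCurve_eq, Matrix.mul_inv_rev, Matrix.mul_inv_rev, Matrix.inv_eq_right_inv h1,
      Matrix.mul_assoc]
  have key : ∀ u v w : Fin d → ℝ,
      sandwich g.1 u * ((g.1ᴴ)⁻¹ * diagMat v * (g.1)⁻¹) * sandwich g.1 w
        = sandwich g.1 (u * v * w) := by
    intro u v w
    simp only [sandwich_apply]
    calc _ = g.1 * diagMat u * (g.1ᴴ * (g.1ᴴ)⁻¹) * diagMat v * ((g.1)⁻¹ * g.1)
          * diagMat w * g.1ᴴ := by simp only [Matrix.mul_assoc]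
      _ = g.1 * (diagMat u * diagMat v * diagMat w) * g.1ᴴ := by
          rw [Matrix.mul_nonsing_inv _ hgH, Matrix.nonsing_inv_mul _ hg]
          simp only [Matrix.mul_assoc, Matrix.mul_one]
      _ = _ := by rw [hmul, hmul]
  refine ⟨?_, ?_, ?_, ?_⟩
  · rw [hc]
    refine (sandwich g.1).contDiff.comp (contDiff_pi.2 fun i => ?_)
    fun_prop
  · intro t
    rw [stdCurve_eq]
    refine ⟨?_, ?_⟩
    · refine Matrix.PosDef.mul_mul_conjTranspose_same (Matrix.PosDef.diagonal fun i => ?_) ?_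
      · exact RCLike.ofReal_pos.2 (Real.exp_pos _)
      · exact Matrix.vecMul_injective_of_isUnit ((Matrix.isUnit_iff_isUnit_det _).2 hg)
    · rw [Matrix.det_mul, Matrix.det_mul, Matrix.det_conjTranspose, g.2, diagMat,
        Matrix.det_diagonal, ← RCLike.ofReal_prod, ← Real.exp_sum, ← Finset.sum_mul,
        ← Finset.mul_sum, hsum]
      simp
  · intro t
    rw [hd2, hd1, hinv, key]
    congr 1
    funext i
    have : Real.exp (2 * a i * t) * Real.exp (-(2 * a i * t)) = 1 := by
      rw [← Real.exp_add]; simp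
    simp only [Pi.mul_apply]
    linear_combination (-(4 * a i ^ 2 * Real.exp (2 * a i * t))) * this
  · intro t
    rw [metric, hd1, hinv]
    set v : Fin d → ℝ := fun i => Real.exp (-(2 * a i * t))
    set u : Fin d → ℝ := fun i => 2 * a i * Real.exp (2 * a i * t)
    have hX : (g.1ᴴ)⁻¹ * diagMat v * (g.1)⁻¹ * sandwich g.1 u * ((g.1ᴴ)⁻¹ * diagMat v * (g.1)⁻¹)
        * sandwich g.1 u = (g.1ᴴ)⁻¹ * (diagMat (v * (u * v * u)) * g.1ᴴ) := by
      rw [Matrix.mul_assoc _ (sandwich g.1 u), Matrix.mul_assoc _ _ (sandwich g.1 u), key,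
        sandwich_apply]
      calc _ = (g.1ᴴ)⁻¹ * (diagMat v * ((g.1)⁻¹ * g.1) * diagMat (u * v * u) * g.1ᴴ) := by
            simp only [Matrix.mul_assoc]
        _ = _ := by
            rw [Matrix.nonsing_inv_mul _ hg, Matrix.mul_one, hmul]
    rw [hX, Matrix.trace_mul_comm, Matrix.mul_assoc, Matrix.mul_nonsing_inv _ hgH, Matrix.mul_one,
      diagMat, Matrix.trace_diagonal, ← RCLike.ofReal_sum, RCLike.ofReal_re]
    have : ∀ i, (v * (u * v * u)) i = 4 * a i ^ 2 := by
      intro i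
      have : Real.exp (2 * a i * t) * Real.exp (-(2 * a i * t)) = 1 := by
        rw [← Real.exp_add]; simp
      simp only [Pi.mul_apply, u, v]
      linear_combination (4 * a i ^ 2 *
        (Real.exp (2 * a i * t) * Real.exp (-(2 * a i * t)) + 1)) * this
    simp only [this, ← Finset.mul_sum]
    linarith

theorem Zvec_mem_sigmaMod [d.AtLeastTwo] : Zvec d ∈ sigmaMod d := by
  have hd : (2 : ℝ) ≤ d := by exact_mod_cast Nat.AtLeastTwo.prop (n := d)
  have hpos : (0 : ℝ) < 2 * d * (d - 1) := by nlinarith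
  obtain ⟨n, rfl⟩ : ∃ n, d = n + 1 := ⟨d - 1, by have := Nat.AtLeastTwo.prop (n := d); omega⟩
  refine ⟨⟨?_, ?_⟩, ?_⟩
  · intro i j hij
    unfold Zvec
    have hij' : i.val ≤ j.val := hij
    gcongr
    split_ifs with h1 h2 <;> first | linarith | omega
  · simp only [Zvec, ← Finset.sum_div, Fin.sum_univ_succ, Fin.val_zero, Fin.val_succ]
    simp
  · simp only [Zvec, div_pow, Real.sq_sqrt hpos.le, ← Finset.sum_div, Fin.sum_univ_succ,
      Fin.val_zero, Fin.val_succ]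
    simp only [if_true, Nat.add_eq_zero_iff, one_ne_zero, and_false, if_false, Finset.sum_const,
      Finset.card_univ, Fintype.card_fin, nsmul_eq_mul]
    rw [mul_div_assoc', div_eq_one_iff_eq hpos.ne']
    push_cast
    ring

/-- The ray `g.c_A` for `A` in the model Weyl chamber. -/
def stdRay (g : Matrix.SpecialLinearGroup (Fin d) 𝕜) (a : sigmaMod d) : Ray d 𝕜 :=
  ⟨stdCurve g a.1, stdCurve_isUnitGeodesic g a.2⟩

instance [d.AtLeastTwo] : Nonempty (Boundary d 𝕜) :=
  ⟨(stdRay 1 ⟨Zvec d, Zvec_mem_sigmaMod⟩).endpoint⟩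

/-- The Weyl chamber at infinity `g.σ_mod`; all Weyl chambers of the visual boundary are of this
form. -/
def idealChamber (g : Matrix.SpecialLinearGroup (Fin d) 𝕜) : Set (Boundary d 𝕜) :=
  {ξ | ∃ a : sigmaMod d, ξ = (stdRay g a).endpoint}

/-- The ideal points of type `ζ`: the `SL(d, 𝕜)`-orbit of the endpoint of `c_Z`. -/
def HasTypeZeta [d.AtLeastTwo] (ξ : Boundary d 𝕜) : Prop :=
  ∃ g : Matrix.SpecialLinearGroup (Fin d) 𝕜, ξ = (stdRay g ⟨Zvec d, Zvec_mem_sigmaMod⟩).endpoint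

/-- `ξ = ox(+∞)`: the ideal point `ξ` is the endpoint of a ray from `o` through `x ≠ o`. -/
def IsEndpointThrough (o x : Mat d 𝕜) (ξ : Boundary d 𝕜) : Prop :=
  ∃ c : Ray d 𝕜, c.1 0 = o ∧ (∃ t : ℝ, 0 < t ∧ c.1 t = x) ∧ c.endpoint = ξ

/-- `η` is of type `ζ` and lies in a common Weyl chamber with `ox(+∞)`. -/
def IsZetaPoint [d.AtLeastTwo] (o x : Mat d 𝕜) (η : Boundary d 𝕜) : Prop :=
  HasTypeZeta η ∧ ∃ ξ, IsEndpointThrough o x ξ ∧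
    ∃ g : Matrix.SpecialLinearGroup (Fin d) 𝕜, ξ ∈ idealChamber g ∧ η ∈ idealChamber g

/-- The ideal point `ζ(ox)`. -/
def zeta [d.AtLeastTwo] (o x : Mat d 𝕜) : Boundary d 𝕜 := Classical.epsilon (IsZetaPoint o x)

/-! ### Directions and angles at a point, smoothness -/

/-- `v` is the initial velocity of a ray from `o` to the ideal point `ξ`. -/
def IsDirection (o : Mat d 𝕜) (ξ : Boundary d 𝕜) (v : Mat d 𝕜) : Prop :=
  ∃ c : Ray d 𝕜, c.1 0 = o ∧ c.endpoint = ξ ∧ deriv c.1 0 = v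

/-- The unit tangent vector at `o` pointing to `ξ`; this is the identification of the visual
boundary with the unit sphere of the tangent space at `o`. -/
def direction (o : Mat d 𝕜) (ξ : Boundary d 𝕜) : Mat d 𝕜 := Classical.epsilon (IsDirection o ξ)

/-- The Riemannian angle at `o` between two ideal points. -/
def angle (o : Mat d 𝕜) (ξ η : Boundary d 𝕜) : ℝ :=
  Real.arccos (metric o (direction o ξ) (direction o η))

/-- The orbit `K.Z` in the tangent space at `o`, `K` being the stabilizer of `o`: the initial
velocities `g (2Z) g†` of the geodesics `g exp (tZ).I` with `g.I = o`. -/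
def orbitZ (o : Mat d 𝕜) : Set (Mat d 𝕜) :=
  {v | ∃ g : Matrix.SpecialLinearGroup (Fin d) 𝕜,
    act g.1 1 = o ∧ v = act g.1 ((2 : ℝ) • diagMat (Zvec d))}

/-- The points `x` of the symmetric space with `d_α(o, x) > 0`. -/
def regularSet [d.AtLeastTwo] (o : Mat d 𝕜) : Set (Mat d 𝕜) :=
  {x | x ∈ SymSpace d 𝕜 ∧ 0 < dAlpha o x}

/-- Smoothness of a map between subsets of real vector spaces (here: embedded submanifolds): near
each point of the domain the map extends to a `C^∞` map on an ambient open set. -/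
def SmoothBetween {E F : Type*} [NormedAddCommGroup E] [NormedSpace ℝ E] [NormedAddCommGroup F]
    [NormedSpace ℝ F] (f : E → F) (A : Set E) (B : Set F) : Prop :=
  Set.MapsTo f A B ∧ ∀ x ∈ A, ∃ (U : Set E) (f' : E → F), IsOpen U ∧ x ∈ U ∧
    ContDiffOn ℝ ∞ f' U ∧ Set.EqOn f' f (A ∩ U)

end SLSym

end

open SLSym

/-!
Everything is reduced to the base point `o = I` by the action of `SL(d, 𝕜)`, and the Riemannian
geometry to linear algebra by diagonalizing a positive definite and a Hermitian matrix
simultaneously (`exists_simultaneous_diagonalization`).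

**The ideal point and its direction.** The geodesic equation says that `c⁻¹ c'` is constant, so
every unit-speed geodesic is a curve `t ↦ g exp (tA).I` (`IsUnitGeodesic.eq_stdCurve`). The
Riemannian distance of two points is bounded in terms of the quotients of their quadratic forms, and conversely
(`rdist_le_of_comparable`, `IsCurve.quadForm_comparable`), so that two rays are asymptotic exactly
if their quadratic forms stay within a constant factor of each other (`endpoint_eq_iff`). Comparing
exponential growth rates shows that `g.c_A` and `k.c_B` are asymptotic only if `A = B` and `g⁻¹ k`
is in the parabolic subgroup of `A` (`Comparable.eq_type`, `Comparable.le_of_ne_zero`). If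
`α (A) > 0`, this subgroup fixes the line of the first basis vector, and then it fixes the end point of `c_Z`
(`comparable_stdCurve_Zvec`). This gives existence and uniqueness of `ζ(ox)`, whose
direction at `I` is an affine function of the projection `P` to the top eigenline of `x`
(`direction_zeta_act`).

**Smoothness.** The top eigenvalue `l` is simple where `d_α > 0`, hence smooth by the implicit
function theorem, and `P = adj (l - x) / tr (adj (l - x))` (`exists_contDiffOn_eq_topProj`).

**The estimate.** If `x` has the eigenvalues `exp (2 a i)`, with eigenvectors `u i`, and moves with
velocity `V`, the nonzero entries of the derivative of `P` are, up to conjugation,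
`⟨u j, V u 0⟩ / (exp (2 a 0) - exp (2 a j))`. Together with
`exp (2 p) - exp (2 q) = 2 exp (p + q) sinh (p - q)` this bounds the speed of
the direction by `α (Z) / sinh (d_α)` times the speed of `x` (`metric_deriv_topProj_le`). The root
pseudodistance `d_α(o, ·)` is 1-Lipschitz (`IsCurve.dAlpha_sub_curveLength_le`), so along a curve
from `x` to `y` of length close to `d(x, y) ≤ D` it is at least about `S - D`. The angle
between the end points of a curve on the unit sphere is at most its length
(`IsCurve.arccos_metric_le`).
-/

open scoped ComplexOrder Matrix Matrix.Norms.Frobenius ContDiff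

noncomputable section

namespace SLSym

variable {d : ℕ} {𝕜 : Type*} [RCLike 𝕜]

/-! ### Simultaneous diagonalization -/

theorem exists_unitary_diagonalization {w : Mat d 𝕜} (hw : w.IsHermitian) :
    ∃ (U : Mat d 𝕜) (a : Fin d → ℝ), Antitone a ∧ U * Uᴴ = 1 ∧ w = U * diagMat a * Uᴴ := by
  set V : Mat d 𝕜 := hw.eigenvectorUnitary.1 with hV
  have hVV : V * Vᴴ = 1 := by
    rw [← Matrix.star_eq_conjTranspose]
    exact Unitary.mul_star_self_of_mem hw.eigenvectorUnitary.2
  have hsp : w = V * diagMat hw.eigenvalues * Vᴴ := by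
    conv_lhs => rw [hw.spectral_theorem]
    rw [Unitary.conjStarAlgAut_apply]
    rfl
  set σ := Tuple.sort (fun i => -hw.eigenvalues i)
  have hσ : Monotone ((fun i => -hw.eigenvalues i) ∘ σ) := Tuple.monotone_sort _
  refine ⟨V.submatrix id σ, hw.eigenvalues ∘ σ, ?_, ?_, ?_⟩
  · intro i j hij
    have := hσ hij
    simp only [Function.comp_apply] at this ⊢
    linarith
  · rw [Matrix.conjTranspose_submatrix, Matrix.submatrix_mul_equiv, hVV]
    simp
  · have : (diagMat (hw.eigenvalues ∘ σ) : Mat d 𝕜) = (diagMat hw.eigenvalues).submatrix σ σ := by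
      simp only [diagMat]
      rw [Matrix.submatrix_diagonal_equiv]
      rfl
    rw [this, Matrix.conjTranspose_submatrix, Matrix.submatrix_mul_equiv,
      Matrix.submatrix_mul_equiv, ← hsp]
    simp

theorem diagMat_mul_diagMat (a b : Fin d → ℝ) :
    (diagMat a : Mat d 𝕜) * diagMat b = diagMat (a * b) := by
  simp [diagMat, Matrix.diagonal_mul_diagonal]

theorem diagMat_conjTranspose (a : Fin d → ℝ) : (diagMat a : Mat d 𝕜)ᴴ = diagMat a := by
  simp only [diagMat, Matrix.diagonal_conjTranspose]
  congr 1
  funext i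
  simp

theorem diagMat_one : (diagMat 1 : Mat d 𝕜) = 1 := by
  simp [diagMat]

theorem det_diagMat (a : Fin d → ℝ) : (diagMat a : Mat d 𝕜).det = ((∏ i, a i : ℝ) : 𝕜) := by
  simp [diagMat, Matrix.det_diagonal]

theorem diagMat_isHermitian (a : Fin d → ℝ) : (diagMat a : Mat d 𝕜).IsHermitian :=
  diagMat_conjTranspose a

/-- `p = U diag (a) U†` with `a` positive has the square root `h = U diag (√a)`, `p = h h†`. -/
theorem exists_mul_conjTranspose_eq {p : Mat d 𝕜} (hp : p.PosDef) :
    ∃ h : Mat d 𝕜, p = h * hᴴ ∧ IsUnit h.det := by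
  obtain ⟨U, a, -, hU, rfl⟩ := exists_unitary_diagonalization hp.isHermitian
  have hUd : IsUnit U.det := by
    refine isUnit_of_mul_isUnit_left (y := Uᴴ.det) ?_
    rw [← Matrix.det_mul, hU]; simp
  have hpos : ∀ i, 0 < a i := by
    intro i
    have h1 : (diagMat a : Mat d 𝕜).PosDef := by
      have h3 : Uᴴ * U = 1 := mul_eq_one_comm.1 hU
      have := hp.conjTranspose_mul_mul_same (B := U)
        (Matrix.mulVec_injective_of_isUnit ((Matrix.isUnit_iff_isUnit_det _).2 hUd))
      convert this using 1
      calc diagMat a = (Uᴴ * U) * diagMat a * (Uᴴ * U) := by rw [h3]; simp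
        _ = _ := by simp only [Matrix.mul_assoc]
    have := h1.diag_pos (i := i)
    simpa [diagMat] using this
  refine ⟨U * diagMat fun i => Real.sqrt (a i), ?_, ?_⟩
  · rw [Matrix.conjTranspose_mul, diagMat_conjTranspose]
    have : (diagMat a : Mat d 𝕜) = (diagMat fun i => √(a i)) * diagMat fun i => √(a i) := by
      rw [diagMat_mul_diagMat]
      congr 1
      funext i
      simp [Real.mul_self_sqrt (hpos i).le]
    rw [this]
    simp only [Matrix.mul_assoc]
  · rw [Matrix.det_mul, det_diagMat]
    refine hUd.mul ?_
    rw [isUnit_iff_ne_zero]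
    have : ∏ i, √(a i) ≠ 0 := Finset.prod_ne_zero_iff.2 fun i _ => (Real.sqrt_pos.2 (hpos i)).ne'
    exact_mod_cast this

theorem isUnit_det_conjTranspose {g : Mat d 𝕜} (hg : IsUnit g.det) : IsUnit (gᴴ).det := by
  rw [Matrix.det_conjTranspose]
  exact hg.star

/-- A positive definite matrix of determinant one and a Hermitian matrix become the identity and a
real diagonal matrix under one and the same congruence, which can be taken in `SL(d, 𝕜)`. -/
theorem exists_simultaneous_diagonalization [NeZero d] {p w : Mat d 𝕜} (hp : p ∈ SymSpace d 𝕜)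
    (hw : w.IsHermitian) : ∃ (g : Matrix.SpecialLinearGroup (Fin d) 𝕜) (a : Fin d → ℝ),
      Antitone a ∧ g.1 * g.1ᴴ = p ∧ w = g.1 * diagMat a * g.1ᴴ := by
  obtain ⟨h, hph, hdet⟩ := exists_mul_conjTranspose_eq hp.1
  have hdetH := isUnit_det_conjTranspose hdet
  have hN : (h⁻¹ * w * (hᴴ)⁻¹).IsHermitian := by
    have := Matrix.isHermitian_mul_mul_conjTranspose h⁻¹ hw
    rwa [Matrix.conjTranspose_nonsing_inv] at this
  obtain ⟨U, a, ha, hU, hUa⟩ := exists_unitary_diagonalization hN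
  -- Multiplying the first column by a phase makes the determinant equal to one.
  set δ : 𝕜 := (h * U).det with hδ
  have hδ1 : δ * star δ = 1 := by
    rw [hδ, ← Matrix.det_conjTranspose, ← Matrix.det_mul, Matrix.conjTranspose_mul]
    calc (h * U * (Uᴴ * hᴴ)).det = (h * (U * Uᴴ) * hᴴ).det := by simp only [Matrix.mul_assoc]
      _ = 1 := by rw [hU, Matrix.mul_one, ← hph, hp.2]
  set e : Mat d 𝕜 := Matrix.diagonal (Function.update 1 0 (star δ)) with he
  have hee : ∀ b : Fin d → ℝ, e * diagMat b * eᴴ = diagMat b := by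
    intro b
    rw [he, diagMat, Matrix.diagonal_conjTranspose, Matrix.diagonal_mul_diagonal,
      Matrix.diagonal_mul_diagonal]
    congr 1
    funext i
    by_cases hi : i = 0
    · subst hi
      simp only [Function.update_self, Pi.star_apply, star_star]
      linear_combination ((b 0 : ℝ) : 𝕜) * hδ1
    · simp [Function.update_of_ne hi]
  have hge : (h * U * e).det = 1 := by
    rw [Matrix.det_mul, ← hδ, he, Matrix.det_diagonal, Finset.prod_update_of_mem (by simp)]
    simpa using hδ1
  have key : ∀ b : Fin d → ℝ, (h * U * e) * diagMat b * (h * U * e)ᴴ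
      = h * (U * diagMat b * Uᴴ) * hᴴ := by
    intro b
    rw [Matrix.conjTranspose_mul, Matrix.conjTranspose_mul]
    calc _ = h * (U * (e * diagMat b * eᴴ) * Uᴴ) * hᴴ := by simp only [Matrix.mul_assoc]
      _ = _ := by rw [hee]
  refine ⟨⟨h * U * e, hge⟩, a, ha, ?_, ?_⟩
  · have := key 1
    rw [diagMat_one, Matrix.mul_one, Matrix.mul_one, hU, Matrix.mul_one, ← hph] at this
    exact this
  · change w = (h * U * e) * diagMat a * (h * U * e)ᴴ
    rw [key a, ← hUa]
    calc w = (h * h⁻¹) * w * ((hᴴ)⁻¹ * hᴴ) := by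
          rw [Matrix.mul_nonsing_inv _ hdet, Matrix.nonsing_inv_mul _ hdetH]; simp
      _ = _ := by simp only [Matrix.mul_assoc]

/-! ### The special linear group acting on the symmetric space -/

theorem isUnit_det_SL (g : Matrix.SpecialLinearGroup (Fin d) 𝕜) : IsUnit g.1.det := by
  rw [g.2]; exact isUnit_one

theorem act_one (g : Mat d 𝕜) : act g 1 = g * gᴴ := by rw [act, Matrix.mul_one]

theorem act_mul (g h x : Mat d 𝕜) : act (g * h) x = act g (act h x) := by
  simp only [act, Matrix.conjTranspose_mul, Matrix.mul_assoc]

theorem one_act (x : Mat d 𝕜) : act 1 x = x := by simp [act]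

theorem act_inv_act (g : Matrix.SpecialLinearGroup (Fin d) 𝕜) (x : Mat d 𝕜) :
    act (g⁻¹).1 (act g.1 x) = x := by
  have : (g⁻¹).1 * g.1 = 1 := by
    rw [← Matrix.SpecialLinearGroup.coe_mul, inv_mul_cancel]; rfl
  rw [← act_mul, this, one_act]

theorem act_act_inv (g : Matrix.SpecialLinearGroup (Fin d) 𝕜) (x : Mat d 𝕜) :
    act g.1 (act (g⁻¹).1 x) = x := by
  simpa using act_inv_act g⁻¹ x

theorem act_mem_symSpace (g : Matrix.SpecialLinearGroup (Fin d) 𝕜) {x : Mat d 𝕜}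
    (hx : x ∈ SymSpace d 𝕜) : act g.1 x ∈ SymSpace d 𝕜 := by
  refine ⟨?_, ?_⟩
  · exact Matrix.PosDef.mul_mul_conjTranspose_same hx.1
      (Matrix.vecMul_injective_of_isUnit ((Matrix.isUnit_iff_isUnit_det _).2 (isUnit_det_SL g)))
  · rw [act, Matrix.det_mul, Matrix.det_mul, Matrix.det_conjTranspose, g.2, hx.2]
    simp

theorem one_mem_symSpace : (1 : Mat d 𝕜) ∈ SymSpace d 𝕜 := ⟨Matrix.PosDef.one, by simp⟩

theorem act_expDiag (g : Mat d 𝕜) (a : Fin d → ℝ) :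
    act (g * expDiag a) 1 = g * diagMat (fun i => Real.exp (2 * a i)) * gᴴ := by
  rw [act_one, Matrix.conjTranspose_mul, expDiag, diagMat_conjTranspose, ← Matrix.mul_assoc,
    Matrix.mul_assoc g, diagMat_mul_diagMat]
  congr 3
  funext i
  rw [Pi.mul_apply, ← Real.exp_add]
  congr 1
  ring

/-- A `d × d` matrix of nonzero determinant has a transversal of nonzero entries. -/
theorem exists_perm_forall_ne_zero {m : Mat d 𝕜} (hm : m.det ≠ 0) :
    ∃ σ : Equiv.Perm (Fin d), ∀ i, m (σ i) i ≠ 0 := by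
  rw [Matrix.det_apply] at hm
  obtain ⟨σ, -, hσ⟩ := Finset.exists_ne_zero_of_sum_ne_zero hm
  refine ⟨σ, fun i hi => hσ ?_⟩
  have : ∏ i, m (σ i) i = 0 := Finset.prod_eq_zero (Finset.mem_univ i) hi
  exact (congrArg _ this).trans (smul_zero _)

theorem antitone_eq_of_comp_perm {a b : Fin d → ℝ} (ha : Antitone a) (hb : Antitone b)
    (σ : Equiv.Perm (Fin d)) (h : ∀ i, a i = b (σ i)) : a = b := by
  have h1 : b ∘ σ = b ∘ (1 : Equiv.Perm (Fin d)) :=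
    Tuple.unique_antitone (fun i j hij => by simpa only [Function.comp_apply, ← h] using ha hij) hb
  funext i
  rw [h i]
  exact congrFun h1 i

theorem eq_mul_inv_mul (g k : Matrix.SpecialLinearGroup (Fin d) 𝕜) : k.1 = g.1 * (g⁻¹ * k).1 := by
  rw [← Matrix.SpecialLinearGroup.coe_mul, mul_inv_cancel_left]

theorem act_injective (g : Matrix.SpecialLinearGroup (Fin d) 𝕜) :
    Function.Injective (act g.1 : Mat d 𝕜 → Mat d 𝕜) :=
  Function.LeftInverse.injective (act_inv_act g)

/-- If `g.I = k.I` then `g⁻¹ k` is unitary. -/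
theorem inv_mul_mul_conjTranspose {g k : Matrix.SpecialLinearGroup (Fin d) 𝕜}
    (h : act g.1 1 = act k.1 1) : (g⁻¹ * k).1 * (g⁻¹ * k).1ᴴ = 1 := by
  rw [← act_one, Matrix.SpecialLinearGroup.coe_mul, act_mul, ← h, act_inv_act]

/-- If `g` and `k` take the pair `(I, exp (A).I)`, respectively `(I, exp (B).I)`, to the same pair
of points, then `g⁻¹ k` intertwines `A` and `B`. -/
theorem eq_of_inv_mul_ne_zero {g k : Matrix.SpecialLinearGroup (Fin d) 𝕜} {a b : Fin d → ℝ}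
    (h : act g.1 1 = act k.1 1) (h' : act (g.1 * expDiag a) 1 = act (k.1 * expDiag b) 1)
    {i j : Fin d} (hij : (g⁻¹ * k).1 i j ≠ 0) : a i = b j := by
  have hmm := mul_eq_one_comm.1 (inv_mul_mul_conjTranspose h)
  have hgm := eq_mul_inv_mul g k
  generalize (g⁻¹ * k).1 = m at hmm hgm hij
  rw [act_expDiag, act_expDiag, hgm, Matrix.conjTranspose_mul] at h'
  have h0 : (diagMat (fun i => Real.exp (2 * a i)) : Mat d 𝕜)
      = m * diagMat (fun i => Real.exp (2 * b i)) * mᴴ := by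
    refine act_injective g ?_
    simp only [act]
    rw [h']
    simp only [Matrix.mul_assoc]
  have h1 : (diagMat (fun i => Real.exp (2 * a i)) : Mat d 𝕜) * m
      = m * diagMat (fun i => Real.exp (2 * b i)) := by
    rw [h0, Matrix.mul_assoc _ mᴴ, hmm, Matrix.mul_one]
  have h2 := congrFun (congrFun h1 i) j
  rw [diagMat, diagMat, Matrix.diagonal_mul, Matrix.mul_diagonal, mul_comm] at h2
  have h3 := mul_left_cancel₀ hij h2
  have h4 := Real.exp_injective (RCLike.ofReal_injective h3)
  linarith

theorem IsVecDist.unique {p q : Mat d 𝕜} {a b : Fin d → ℝ} (ha : IsVecDist p q a)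
    (hb : IsVecDist p q b) : a = b := by
  obtain ⟨⟨ha, -⟩, g, hg, hgq⟩ := ha
  obtain ⟨⟨hb, -⟩, k, hk, hkq⟩ := hb
  obtain ⟨σ, hσ⟩ := exists_perm_forall_ne_zero (isUnit_det_SL (g⁻¹ * k)).ne_zero
  exact (antitone_eq_of_comp_perm hb ha σ fun i =>
    (eq_of_inv_mul_ne_zero (hg.trans hk.symm) (hgq.trans hkq.symm) (hσ i)).symm).symm

theorem exists_isVecDist [NeZero d] {p q : Mat d 𝕜} (hp : p ∈ SymSpace d 𝕜)
    (hq : q ∈ SymSpace d 𝕜) : ∃ a, IsVecDist p q a := by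
  obtain ⟨g, l, hl, hgp, hgq⟩ := exists_simultaneous_diagonalization hp hq.1.isHermitian
  have hD : (diagMat l : Mat d 𝕜) = act (g⁻¹).1 q := by
    rw [hgq]
    exact (act_inv_act g _).symm
  have hDm : (diagMat l : Mat d 𝕜) ∈ SymSpace d 𝕜 := hD ▸ act_mem_symSpace _ hq
  have hpos : ∀ i, 0 < l i := by
    intro i
    have := hDm.1.diag_pos (i := i)
    simpa [diagMat] using this
  have hexp : (fun i => Real.exp (2 * (Real.log (l i) / 2))) = l := by
    funext i
    rw [mul_div_cancel₀ _ two_ne_zero, Real.exp_log (hpos i)]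
  refine ⟨fun i => Real.log (l i) / 2, ⟨?_, ?_⟩, g, ?_, ?_⟩
  · intro i j hij
    have := Real.log_le_log (hpos j) (hl hij)
    simp only
    linarith
  · rw [← Finset.sum_div, ← Real.log_prod (fun i _ => (hpos i).ne')]
    have h1 := hDm.2
    rw [det_diagMat] at h1
    have h2 : ∏ i, l i = 1 := by exact_mod_cast h1
    rw [h2]; simp
  · rw [act_one, hgp]
  · rw [act_expDiag, hexp, ← hgq]

theorem IsVecDist.vecDist_eq {p q : Mat d 𝕜} {a : Fin d → ℝ} (ha : IsVecDist p q a) :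
    vecDist p q = a :=
  (Classical.epsilon_spec (⟨a, ha⟩ : ∃ a, IsVecDist p q a)).unique ha

theorem isVecDist_vecDist [NeZero d] {p q : Mat d 𝕜} (hp : p ∈ SymSpace d 𝕜)
    (hq : q ∈ SymSpace d 𝕜) : IsVecDist p q (vecDist p q) :=
  Classical.epsilon_spec (exists_isVecDist hp hq)

/-! ### Quadratic forms and the metric in diagonal coordinates -/

/-- The quadratic form `u† X u` of a Hermitian matrix `X` (in general, its real part). -/
def quadForm (X : Mat d 𝕜) (u : Fin d → 𝕜) : ℝ := RCLike.re (star u ⬝ᵥ X *ᵥ u)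

theorem quadForm_mul_diagMat_mul (g : Mat d 𝕜) (a : Fin d → ℝ) (u : Fin d → 𝕜) :
    quadForm (g * diagMat a * gᴴ) u = ∑ i, a i * ‖(gᴴ *ᵥ u) i‖ ^ 2 := by
  have h1 : star u ⬝ᵥ (g * diagMat a * gᴴ) *ᵥ u = star (gᴴ *ᵥ u) ⬝ᵥ diagMat a *ᵥ (gᴴ *ᵥ u) := by
    rw [Matrix.star_mulVec, Matrix.conjTranspose_conjTranspose, ← Matrix.dotProduct_mulVec,
      Matrix.mulVec_mulVec, Matrix.mulVec_mulVec]
  rw [quadForm, h1, diagMat, dotProduct, map_sum]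
  refine Finset.sum_congr rfl fun i _ => ?_
  rw [Matrix.mulVec_diagonal, Pi.star_apply, mul_left_comm, RCLike.re_ofReal_mul, RCLike.star_def,
    RCLike.conj_mul]
  norm_cast

theorem quadForm_mul_conjTranspose (g : Mat d 𝕜) (u : Fin d → 𝕜) :
    quadForm (g * gᴴ) u = ∑ i, ‖(gᴴ *ᵥ u) i‖ ^ 2 := by
  have := quadForm_mul_diagMat_mul g 1 u
  simpa [diagMat_one] using this

theorem quadForm_pos {x : Mat d 𝕜} (hx : x.PosDef) {u : Fin d → 𝕜} (hu : u ≠ 0) :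
    0 < quadForm x u :=
  hx.re_dotProduct_pos hu

theorem quadForm_zero (x : Mat d 𝕜) : quadForm x 0 = 0 := by simp [quadForm]

/-- The quadratic form at `u`, as a linear functional of the matrix. -/
def quadFormCLM (u : Fin d → 𝕜) : Mat d 𝕜 →L[ℝ] ℝ :=
  LinearMap.toContinuousLinearMap
    { toFun := fun X => quadForm X u
      map_add' := fun X Y => by simp [quadForm, Matrix.add_mulVec, dotProduct_add]
      map_smul' := fun r X => by
        simp [quadForm, Matrix.smul_mulVec, dotProduct_smul, RCLike.smul_re] }

theorem metric_act {g : Mat d 𝕜} (hg : IsUnit g.det) (p v w : Mat d 𝕜) :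
    metric (act g p) (act g v) (act g w) = metric p v w := by
  have hgH := isUnit_det_conjTranspose hg
  have h1 : (act g p)⁻¹ * act g v * (act g p)⁻¹ * act g w
      = (gᴴ)⁻¹ * (p⁻¹ * v * p⁻¹ * w * gᴴ) := by
    simp only [act, Matrix.mul_inv_rev]
    calc _ = (gᴴ)⁻¹ * (p⁻¹ * (g⁻¹ * g) * v * (gᴴ * (gᴴ)⁻¹) * p⁻¹ * (g⁻¹ * g) * w * gᴴ) := by
          simp only [Matrix.mul_assoc]
      _ = _ := by
          rw [Matrix.nonsing_inv_mul _ hg, Matrix.mul_nonsing_inv _ hgH]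
          simp only [Matrix.mul_assoc, Matrix.mul_one]
  rw [metric, metric, h1, Matrix.trace_mul_comm, Matrix.mul_assoc, Matrix.mul_nonsing_inv _ hgH,
    Matrix.mul_one]

theorem metric_one_diagMat (a b : Fin d → ℝ) :
    metric (1 : Mat d 𝕜) (diagMat a) (diagMat b) = 1 / 2 * ∑ i, a i * b i := by
  rw [metric, inv_one, Matrix.one_mul, Matrix.mul_one, diagMat_mul_diagMat, diagMat,
    Matrix.trace_diagonal, ← RCLike.ofReal_sum, RCLike.ofReal_re]
  rfl

theorem metric_mul_conjTranspose {g : Mat d 𝕜} (hg : IsUnit g.det) (a b : Fin d → ℝ) :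
    metric (g * gᴴ) (g * diagMat a * gᴴ) (g * diagMat b * gᴴ) = 1 / 2 * ∑ i, a i * b i := by
  rw [← metric_one_diagMat (𝕜 := 𝕜), ← act_one]
  exact metric_act hg _ _ _

theorem exists_antitone_coordinates [NeZero d] {p v : Mat d 𝕜} (hp : p ∈ SymSpace d 𝕜)
    (hv : v.IsHermitian) : ∃ a : Fin d → ℝ, Antitone a ∧
      metric p v v = 1 / 2 * ∑ i, a i ^ 2 ∧ ∀ u, ∃ z : Fin d → 𝕜,
        quadForm p u = ∑ i, ‖z i‖ ^ 2 ∧ quadForm v u = ∑ i, a i * ‖z i‖ ^ 2 := by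
  obtain ⟨g, a, ha, rfl, rfl⟩ := exists_simultaneous_diagonalization hp hv
  refine ⟨a, ha, ?_, fun u => ⟨(g.1ᴴ) *ᵥ u, quadForm_mul_conjTranspose _ _,
    quadForm_mul_diagMat_mul _ _ _⟩⟩
  rw [metric_mul_conjTranspose (isUnit_det_SL g)]
  simp only [sq]

theorem metric_self_nonneg [NeZero d] {p v : Mat d 𝕜} (hp : p ∈ SymSpace d 𝕜)
    (hv : v.IsHermitian) : 0 ≤ metric p v v := by
  obtain ⟨a, -, h, -⟩ := exists_antitone_coordinates hp hv
  rw [h]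
  positivity

theorem abs_quadForm_le [NeZero d] {p v : Mat d 𝕜} (hp : p ∈ SymSpace d 𝕜) (hv : v.IsHermitian)
    (u : Fin d → 𝕜) : |quadForm v u| ≤ 2 * √(metric p v v) * quadForm p u := by
  obtain ⟨a, -, h, hz⟩ := exists_antitone_coordinates hp hv
  obtain ⟨z, hpz, hvz⟩ := hz u
  have hle : ∀ i, |a i| ≤ 2 * √(metric p v v) := by
    intro i
    refine abs_le_of_sq_le_sq ?_ (by positivity)
    have : a i ^ 2 ≤ ∑ i, a i ^ 2 :=
      Finset.single_le_sum (f := fun i => a i ^ 2) (fun j _ => sq_nonneg _) (Finset.mem_univ i)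
    rw [mul_pow, Real.sq_sqrt (metric_self_nonneg hp hv), h]
    nlinarith [sq_nonneg (a i)]
  rw [hpz, hvz, Finset.mul_sum]
  refine (Finset.abs_sum_le_sum_abs _ _).trans (Finset.sum_le_sum fun i _ => ?_)
  rw [abs_mul, abs_of_nonneg (sq_nonneg ‖z i‖)]
  exact mul_le_mul_of_nonneg_right (hle i) (sq_nonneg _)

/-- The logarithmic derivatives of the quadratic form at two vectors differ by at most twice the
speed. In diagonal coordinates they are weighted means of the entries `a i`, and
`a 0 - a (d - 1) ≤ √(2 ∑ a i ^ 2)`. -/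
theorem quadForm_div_sub_div_le [d.AtLeastTwo] {p v : Mat d 𝕜} (hp : p ∈ SymSpace d 𝕜)
    (hv : v.IsHermitian) {u w : Fin d → 𝕜} (hu : u ≠ 0) (hw : w ≠ 0) :
    quadForm v w / quadForm p w - quadForm v u / quadForm p u ≤ 2 * √(metric p v v) := by
  obtain ⟨n, rfl⟩ : ∃ n, d = n + 2 := ⟨d - 2, by have := Nat.AtLeastTwo.prop (n := d); omega⟩
  obtain ⟨a, ha, h, hz⟩ := exists_antitone_coordinates hp hv
  have hup := quadForm_pos hp.1 hu
  have hwp := quadForm_pos hp.1 hw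
  have h1 : quadForm v w ≤ a 0 * quadForm p w := by
    obtain ⟨z, hpz, hvz⟩ := hz w
    rw [hpz, hvz, Finset.mul_sum]
    exact Finset.sum_le_sum fun i _ =>
      mul_le_mul_of_nonneg_right (ha (Fin.zero_le i)) (sq_nonneg _)
  have h2 : a (Fin.last _) * quadForm p u ≤ quadForm v u := by
    obtain ⟨z, hpz, hvz⟩ := hz u
    rw [hpz, hvz, Finset.mul_sum]
    exact Finset.sum_le_sum fun i _ =>
      mul_le_mul_of_nonneg_right (ha (Fin.le_last i)) (sq_nonneg _)
  have h3 : a 0 - a (Fin.last _) ≤ 2 * √(metric p v v) := by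
    refine le_of_abs_le (abs_le_of_sq_le_sq ?_ (by positivity))
    rw [mul_pow, Real.sq_sqrt (metric_self_nonneg hp hv), h, Fin.sum_univ_succ,
      Fin.sum_univ_castSucc]
    have : 0 ≤ ∑ i : Fin n, a i.castSucc.succ ^ 2 := Finset.sum_nonneg fun i _ => sq_nonneg _
    rw [Fin.succ_last]
    nlinarith [sq_nonneg (a 0 + a (Fin.last (n + 1)))]
  have h4 : quadForm v w / quadForm p w ≤ a 0 := (div_le_iff₀ hwp).2 h1
  have h5 : a (Fin.last _) ≤ quadForm v u / quadForm p u := (le_div_iff₀ hup).2 h2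
  linarith

/-! ### Curves in the symmetric space and their lengths -/

/-- `γ` is one of the curves from `x` to `y` over whose lengths the infimum in the definition of
the Riemannian distance is taken. -/
structure IsCurve (γ : ℝ → Mat d 𝕜) (x y : Mat d 𝕜) : Prop where
  contDiff : ContDiff ℝ 1 γ
  mem : ∀ t ∈ Set.Icc (0 : ℝ) 1, γ t ∈ SymSpace d 𝕜
  source : γ 0 = x
  target : γ 1 = y

/-- The speed of a curve. -/
def speed (γ : ℝ → Mat d 𝕜) (t : ℝ) : ℝ := √(metric (γ t) (deriv γ t) (deriv γ t))

theorem curveLength_eq (γ : ℝ → Mat d 𝕜) : curveLength γ = ∫ t in (0 : ℝ)..1, speed γ t := rfl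

theorem speed_nonneg (γ : ℝ → Mat d 𝕜) (t : ℝ) : 0 ≤ speed γ t := Real.sqrt_nonneg _

theorem curveLength_nonneg (γ : ℝ → Mat d 𝕜) : 0 ≤ curveLength γ :=
  intervalIntegral.integral_nonneg zero_le_one fun t _ => speed_nonneg γ t

theorem IsCurve.hasDerivAt {γ : ℝ → Mat d 𝕜} {x y : Mat d 𝕜} (h : IsCurve γ x y) (t : ℝ) :
    HasDerivAt γ (deriv γ t) t :=
  (h.contDiff.differentiable (by simp) t).hasDerivAt

theorem continuous_trace_re : Continuous fun X : Mat d 𝕜 => RCLike.re X.trace :=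
  RCLike.continuous_re.comp (continuous_id.matrix_trace)

theorem IsCurve.continuousOn_speed {γ : ℝ → Mat d 𝕜} {x y : Mat d 𝕜} (h : IsCurve γ x y) :
    ContinuousOn (speed γ) (Set.Icc 0 1) := by
  have hγ : Continuous γ := h.contDiff.continuous
  have hγ' : Continuous (deriv γ) := h.contDiff.continuous_deriv (by simp)
  have hadj : Continuous fun t => (γ t).adjugate := hγ.matrix_adjugate
  have h1 : Continuous fun t => √((1 / 2) *
      RCLike.re ((γ t).adjugate * deriv γ t * (γ t).adjugate * deriv γ t).trace) := by
    refine Real.continuous_sqrt.comp (continuous_const.mul (continuous_trace_re.comp ?_))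
    exact ((hadj.mul hγ').mul hadj).mul hγ'
  refine h1.continuousOn.congr fun t ht => ?_
  simp only [speed, metric, Matrix.inv_def, (h.mem t ht).2, Ring.inverse_one, one_smul]

theorem isHermitian_deriv {γ : ℝ → Mat d 𝕜} {γ' : Mat d 𝕜} {t : ℝ}
    (hmem : ∀ᶠ s in nhds t, (γ s).IsHermitian) (h : HasDerivAt γ γ' t) : γ'.IsHermitian := by
  exact (h.star.congr_of_eventuallyEq (hmem.mono fun s hs => hs.eq.symm)).unique h

theorem IsCurve.isHermitian_deriv {γ : ℝ → Mat d 𝕜} {x y : Mat d 𝕜} (h : IsCurve γ x y) {t : ℝ}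
    (ht : t ∈ Set.Ioo (0 : ℝ) 1) : (deriv γ t).IsHermitian := by
  refine SLSym.isHermitian_deriv ?_ (h.hasDerivAt t)
  filter_upwards [Icc_mem_nhds ht.1 ht.2] with s hs
  exact (h.mem s hs).1.isHermitian

theorem IsCurve.act {γ : ℝ → Mat d 𝕜} {x y : Mat d 𝕜} (h : IsCurve γ x y)
    (g : Matrix.SpecialLinearGroup (Fin d) 𝕜) :
    IsCurve (fun t => act g.1 (γ t)) (act g.1 x) (act g.1 y) := by
  refine ⟨?_, fun t ht => act_mem_symSpace g (h.mem t ht), by rw [h.source], by rw [h.target]⟩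
  exact (contDiff_const.mul h.contDiff).mul contDiff_const

theorem IsCurve.curveLength_act {γ : ℝ → Mat d 𝕜} {x y : Mat d 𝕜} (h : IsCurve γ x y)
    (g : Matrix.SpecialLinearGroup (Fin d) 𝕜) :
    curveLength (fun t => SLSym.act g.1 (γ t)) = curveLength γ := by
  have : ∀ t, deriv (fun t => SLSym.act g.1 (γ t)) t = SLSym.act g.1 (deriv γ t) := fun t =>
    (((h.hasDerivAt t).const_mul g.1).mul_const (g.1ᴴ)).deriv
  simp only [curveLength, this, metric_act (isUnit_det_SL g)]

/-- A function whose derivative is at most `κ` times the speed grows by at most `κ` times the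
length. -/
theorem IsCurve.sub_le_mul_curveLength {γ : ℝ → Mat d 𝕜} {x y : Mat d 𝕜} (h : IsCurve γ x y)
    {f f' : ℝ → ℝ} {κ : ℝ} (hκ : 0 ≤ κ) (hf : ContinuousOn f (Set.Icc 0 1))
    (hf' : ∀ t ∈ Set.Ioo (0 : ℝ) 1, HasDerivAt f (f' t) t)
    (hle : ∀ t ∈ Set.Ioo (0 : ℝ) 1, f' t ≤ κ * speed γ t) {t : ℝ} (ht : t ∈ Set.Icc (0 : ℝ) 1) :
    f t - f 0 ≤ κ * curveLength γ := by
  have hs := h.continuousOn_speed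
  have hsub : Set.Icc 0 t ⊆ Set.Icc (0 : ℝ) 1 := Set.Icc_subset_Icc_right ht.2
  have hsub' : Set.Ioo 0 t ⊆ Set.Ioo (0 : ℝ) 1 := Set.Ioo_subset_Ioo_right ht.2
  have h1 : f t - f 0 ≤ ∫ s in (0 : ℝ)..t, κ * speed γ s :=
    intervalIntegral.sub_le_integral_of_hasDeriv_right_of_le ht.1 (hf.mono hsub)
      (fun s hs => (hf' s (hsub' hs)).hasDerivWithinAt)
      ((continuousOn_const.mul (hs.mono hsub)).integrableOn_Icc) fun s hs => hle s (hsub' hs)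
  refine h1.trans ?_
  rw [intervalIntegral.integral_const_mul, curveLength_eq]
  refine mul_le_mul_of_nonneg_left ?_ hκ
  refine intervalIntegral.integral_mono_interval le_rfl ht.1 ht.2
    (Filter.Eventually.of_forall fun s => speed_nonneg γ s) ?_
  exact (hs.mono (Set.uIcc_of_le zero_le_one).subset).intervalIntegrable

theorem IsCurve.hasDerivAt_log_quadForm {γ : ℝ → Mat d 𝕜} {x y : Mat d 𝕜} (h : IsCurve γ x y)
    {u : Fin d → 𝕜} (hu : u ≠ 0) {t : ℝ} (ht : t ∈ Set.Icc (0 : ℝ) 1) :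
    HasDerivAt (fun s => Real.log (quadForm (γ s) u)) (quadForm (deriv γ t) u / quadForm (γ t) u)
      t :=
  ((quadFormCLM u).hasFDerivAt.comp_hasDerivAt t (h.hasDerivAt t)).log
    (quadForm_pos (h.mem t ht).1 hu).ne'

theorem IsCurve.quadForm_comparable [NeZero d] {γ : ℝ → Mat d 𝕜} {x y : Mat d 𝕜}
    (h : IsCurve γ x y) (u : Fin d → 𝕜) :
    quadForm y u ≤ Real.exp (2 * curveLength γ) * quadForm x u ∧
      quadForm x u ≤ Real.exp (2 * curveLength γ) * quadForm y u := by
  rcases eq_or_ne u 0 with rfl | hu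
  · simp [quadForm_zero]
  have hpos : ∀ t ∈ Set.Icc (0 : ℝ) 1, 0 < quadForm (γ t) u :=
    fun t ht => quadForm_pos (h.mem t ht).1 hu
  have h0 := hpos 0 (by simp)
  have h1 := hpos 1 (by simp)
  have key : ∀ σ : ℝ, |σ| = 1 →
      σ * Real.log (quadForm y u) - σ * Real.log (quadForm x u) ≤ 2 * curveLength γ := by
    intro σ hσ
    have := h.sub_le_mul_curveLength (κ := 2) (by norm_num)
      (fun t ht => ((h.hasDerivAt_log_quadForm hu ht).const_mul σ).continuousAt.continuousWithinAt)
      (fun t ht => (h.hasDerivAt_log_quadForm hu (Set.Ioo_subset_Icc_self ht)).const_mul σ)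
      (fun t ht => by
        have ht' := Set.Ioo_subset_Icc_self ht
        refine (le_abs_self _).trans ?_
        rw [abs_mul, hσ, one_mul, abs_div, abs_of_pos (hpos t ht'), div_le_iff₀ (hpos t ht')]
        exact abs_quadForm_le (h.mem t ht') (h.isHermitian_deriv ht) u)
      (t := 1) (by simp)
    rwa [h.source, h.target] at this
  rw [h.source] at h0
  rw [h.target] at h1
  have k1 := key 1 (by simp)
  have k2 := key (-1) (by simp)
  constructor
  · rw [← Real.log_le_log_iff h1 (by positivity), Real.log_mul (Real.exp_pos _).ne' h0.ne',
      Real.log_exp]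
    linarith
  · rw [← Real.log_le_log_iff h0 (by positivity), Real.log_mul (Real.exp_pos _).ne' h1.ne',
      Real.log_exp]
    linarith

/-- Along a curve the ratio of the values of the quadratic form at two vectors changes at most by
the factor `exp (2 L)`, where `L` is the length. -/
theorem IsCurve.quadForm_mul_quadForm_le [d.AtLeastTwo] {γ : ℝ → Mat d 𝕜} {x y : Mat d 𝕜}
    (h : IsCurve γ x y) {u w : Fin d → 𝕜} (hu : u ≠ 0) (hw : w ≠ 0) {t : ℝ}
    (ht : t ∈ Set.Icc (0 : ℝ) 1) :
    quadForm (γ t) w * quadForm x u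
      ≤ Real.exp (2 * curveLength γ) * (quadForm (γ t) u * quadForm x w) := by
  have hpos : ∀ {u : Fin d → 𝕜}, u ≠ 0 → ∀ t ∈ Set.Icc (0 : ℝ) 1, 0 < quadForm (γ t) u :=
    fun hu t ht => quadForm_pos (h.mem t ht).1 hu
  have hd := fun t ht => (h.hasDerivAt_log_quadForm hw (t := t) ht).sub
    (h.hasDerivAt_log_quadForm hu ht)
  have := h.sub_le_mul_curveLength (κ := 2) (by norm_num)
    (fun t ht => (hd t ht).continuousAt.continuousWithinAt)
    (fun t ht => hd t (Set.Ioo_subset_Icc_self ht))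
    (fun t ht => quadForm_div_sub_div_le (h.mem t (Set.Ioo_subset_Icc_self ht))
      (h.isHermitian_deriv ht) hu hw) ht
  have hx := h.mem 0 (by simp)
  rw [h.source] at hx
  simp only [Pi.sub_apply, h.source] at this
  have p1 := hpos hu t ht
  have p2 := hpos hw t ht
  have p3 := quadForm_pos hx.1 hu
  have p4 := quadForm_pos hx.1 hw
  rw [← Real.log_le_log_iff (by positivity) (by positivity), Real.log_mul p2.ne' p3.ne',
    Real.log_mul (Real.exp_pos _).ne' (by positivity), Real.log_mul p1.ne' p4.ne', Real.log_exp]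
  linarith

theorem IsCurve.rdist_le {γ : ℝ → Mat d 𝕜} {x y : Mat d 𝕜} (h : IsCurve γ x y) :
    rdist x y ≤ curveLength γ := by
  refine csInf_le ⟨0, ?_⟩ ⟨γ, h.contDiff, h.mem, h.source, h.target, rfl⟩
  rintro _ ⟨γ, -, -, -, -, rfl⟩
  exact curveLength_nonneg γ

/-- The geodesic `t ↦ g exp (tA).I` from `p` to `q` has length `√(2 Tr (A²))`. -/
theorem IsVecDist.exists_isCurve {p q : Mat d 𝕜} {a : Fin d → ℝ} (h : IsVecDist p q a) :
    ∃ γ, IsCurve γ p q ∧ curveLength γ = √(2 * ∑ i, a i ^ 2) := by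
  obtain ⟨⟨ha, hsum⟩, g, hp, hq⟩ := h
  set r := √(2 * ∑ i, a i ^ 2) with hr
  have hnn : 0 ≤ 2 * ∑ i, a i ^ 2 := by positivity
  -- For `r > 0` the geodesic is the unit-speed geodesic of `a / r`, traversed at speed `r`.
  rcases (Real.sqrt_nonneg (2 * ∑ i, a i ^ 2)).eq_or_lt with h0 | hpos
  · have ha0 : a = 0 := by
      have h1 := (Real.sqrt_eq_zero hnn).1 h0.symm
      have h2 := (Finset.sum_eq_zero_iff_of_nonneg fun i _ => sq_nonneg (a i)).1
        ((mul_eq_zero.1 h1).resolve_left two_ne_zero)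
      funext i
      exact pow_eq_zero_iff two_ne_zero |>.1 (h2 i (Finset.mem_univ i))
    have hpq : q = p := by
      rw [← hq, ← hp, ha0, act_expDiag, act_one]
      simp [diagMat]
    subst hpq
    refine ⟨fun _ => q, ⟨contDiff_const, fun t _ => ?_, rfl, rfl⟩, ?_⟩
    · rw [← hp]; exact act_mem_symSpace g one_mem_symSpace
    · rw [hr, ← h0]
      have : ∀ t : ℝ, deriv (fun _ : ℝ => q) t = 0 := fun t => (hasDerivAt_const t q).deriv
      simp [curveLength, metric, this]
  · rw [← hr] at hpos
    have hb : (fun i => a i / r) ∈ sigmaMod d := by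
      refine ⟨⟨fun i j hij => div_le_div_of_nonneg_right (ha hij) hpos.le, ?_⟩, ?_⟩
      · rw [← Finset.sum_div, hsum, zero_div]
      · simp only [div_pow, ← Finset.sum_div]
        rw [mul_div_assoc', hr, Real.sq_sqrt hnn, div_self]
        intro h; rw [h, Real.sqrt_zero] at hr; exact hpos.ne' hr
    have hgeo := stdCurve_isUnitGeodesic g hb
    have hd : ∀ t, HasDerivAt (fun t => stdCurve g (fun i => a i / r) (r * t))
        (r • deriv (stdCurve g (fun i => a i / r)) (r * t)) t := by
      intro t
      have h1 := (hgeo.smooth.differentiable (by simp) (r * t)).hasDerivAt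
      have h2 : HasDerivAt (fun t : ℝ => r * t) r t := by
        simpa using (hasDerivAt_id t).const_mul r
      exact h1.scomp t h2
    refine ⟨fun t => stdCurve g (fun i => a i / r) (r * t), ⟨?_, ?_, ?_, ?_⟩, ?_⟩
    · exact (hgeo.smooth.comp (contDiff_const.mul contDiff_id)).of_le (by simp)
    · exact fun t _ => hgeo.mem _
    · simp only [stdCurve]
      rw [← hp, act_expDiag, act_one]
      simp [diagMat]
    · simp only [stdCurve]
      rw [← hq]
      congr 3
      funext i
      field_simp
    · have : ∀ t, metric (stdCurve g (fun i => a i / r) (r * t))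
          (r • deriv (stdCurve g (fun i => a i / r)) (r * t))
          (r • deriv (stdCurve g (fun i => a i / r)) (r * t)) = r ^ 2 := by
        intro t
        have h1 := hgeo.unit (r * t)
        rw [metric] at h1 ⊢
        simp only [Matrix.mul_smul, Matrix.smul_mul, Matrix.trace_smul, RCLike.smul_re]
        linear_combination r ^ 2 * h1
      have hd' : ∀ t, deriv (fun t => stdCurve g (fun i => a i / r) (r * t)) t
          = r • deriv (stdCurve g (fun i => a i / r)) (r * t) := fun t => (hd t).deriv
      simp only [curveLength, hd', this, Real.sqrt_sq hpos.le]
      simp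

theorem IsVecDist.rdist_le {p q : Mat d 𝕜} {a : Fin d → ℝ} (h : IsVecDist p q a) :
    rdist p q ≤ √(2 * ∑ i, a i ^ 2) := by
  obtain ⟨γ, hγ, hL⟩ := h.exists_isCurve
  exact hL ▸ hγ.rdist_le

theorem exists_isCurve_curveLength_lt [NeZero d] {x y : Mat d 𝕜} (hx : x ∈ SymSpace d 𝕜)
    (hy : y ∈ SymSpace d 𝕜) {r : ℝ} (hr : rdist x y < r) :
    ∃ γ, IsCurve γ x y ∧ curveLength γ < r := by
  obtain ⟨a, ha⟩ := exists_isVecDist hx hy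
  obtain ⟨γ, hγ, -⟩ := ha.exists_isCurve
  rw [rdist] at hr
  obtain ⟨_, ⟨γ, h1, h2, h3, h4, rfl⟩, hlt⟩ := exists_lt_of_csInf_lt
    (by exact ⟨_, γ, hγ.contDiff, hγ.mem, hγ.source, hγ.target, rfl⟩) hr
  exact ⟨γ, ⟨h1, h2, h3, h4⟩, hlt⟩

/-! ### Unit-speed geodesics -/

theorem stdCurve_eq_sandwich (g : Matrix.SpecialLinearGroup (Fin d) 𝕜) (a : Fin d → ℝ) (t : ℝ) :
    stdCurve g a t = sandwich g.1 (fun i => Real.exp (2 * a i * t)) := by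
  rw [stdCurve_eq, sandwich_apply]

theorem stdCurve_zero (g : Matrix.SpecialLinearGroup (Fin d) 𝕜) (a : Fin d → ℝ) :
    stdCurve g a 0 = act g.1 1 := by
  rw [stdCurve_eq, act_one]
  simp [diagMat]

theorem hasDerivAt_stdCurve (g : Matrix.SpecialLinearGroup (Fin d) 𝕜) (a : Fin d → ℝ) (t : ℝ) :
    HasDerivAt (stdCurve g a) (sandwich g.1 fun i => 2 * a i * Real.exp (2 * a i * t)) t := by
  have hE : ∀ i,
      HasDerivAt (fun t => Real.exp (2 * a i * t)) (2 * a i * Real.exp (2 * a i * t)) t := by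
    intro i
    simpa [mul_comm] using ((hasDerivAt_id t).const_mul (2 * a i)).exp
  rw [show stdCurve g a = fun t => sandwich g.1 (fun i => Real.exp (2 * a i * t)) from
    funext (stdCurve_eq_sandwich g a)]
  exact (sandwich g.1).hasFDerivAt.comp_hasDerivAt t (hasDerivAt_pi.2 hE)

theorem deriv_stdCurve_zero (g : Matrix.SpecialLinearGroup (Fin d) 𝕜) (a : Fin d → ℝ) :
    deriv (stdCurve g a) 0 = act g.1 ((2 : ℝ) • diagMat a) := by
  refine (hasDerivAt_stdCurve g a 0).deriv.trans ?_
  rw [sandwich_apply, act]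
  congr 2
  ext i j
  by_cases h : i = j <;> simp [diagMat, h, RCLike.real_smul_eq_coe_mul]

theorem isUnit_det_of_mem {x : Mat d 𝕜} (hx : x ∈ SymSpace d 𝕜) : IsUnit x.det := by
  rw [hx.2]; exact isUnit_one

/-- The geodesic equation says that `c⁻¹ c'` is constant. -/
theorem IsUnitGeodesic.hasDerivAt {c : ℝ → Mat d 𝕜} (hc : IsUnitGeodesic c) (t : ℝ) :
    HasDerivAt c (c t * ((c 0)⁻¹ * deriv c 0)) t := by
  have hu := fun t => isUnit_det_of_mem (hc.mem t)
  have hd : ∀ t, HasDerivAt c (deriv c t) t := fun t =>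
    (hc.smooth.differentiable (by simp) t).hasDerivAt
  have hd2 : ∀ t, HasDerivAt (deriv c) (deriv (deriv c) t) t := fun t => by
    exact ((contDiff_infty_iff_deriv.1 hc.smooth).2.differentiable (by simp) t).hasDerivAt
  have hinv : ∀ t, HasDerivAt (fun s => (c s)⁻¹) (-((c t)⁻¹ * deriv c t * (c t)⁻¹)) t := by
    intro t
    have hunit := (Matrix.isUnit_iff_isUnit_det _).2 (hu t)
    have h1 := hasFDerivAt_ringInverse (𝕜 := ℝ) hunit.unit
    have h2 := h1.comp_hasDerivAt t (hd t)
    have h3 : (fun s => (c s)⁻¹) = Ring.inverse ∘ c := by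
      funext s
      rw [Matrix.nonsing_inv_eq_ringInverse]; rfl
    rw [h3]
    refine h2.congr_deriv ?_
    have h4 : (↑hunit.unit⁻¹ : Mat d 𝕜) = (c t)⁻¹ := by
      rw [Matrix.nonsing_inv_eq_ringInverse, ← Ring.inverse_unit]; rfl
    change -((↑hunit.unit⁻¹ : Mat d 𝕜) * deriv c t * (↑hunit.unit⁻¹ : Mat d 𝕜)) = _
    rw [h4]
  have hM : ∀ t, HasDerivAt (fun s => (c s)⁻¹ * deriv c s) 0 t := by
    intro t
    refine ((hinv t).mul (hd2 t)).congr_deriv ?_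
    rw [hc.geodesic t]
    simp only [Matrix.mul_assoc, Matrix.neg_mul]
    simp
  have hconst : (c t)⁻¹ * deriv c t = (c 0)⁻¹ * deriv c 0 :=
    is_const_of_deriv_eq_zero (fun s => (hM s).differentiableAt) (fun s => (hM s).deriv) t 0
  rw [← hconst, ← Matrix.mul_assoc, Matrix.mul_nonsing_inv _ (hu t), Matrix.one_mul]
  exact hd t

/-- Every unit-speed geodesic is of the form `t ↦ g exp (tA).I`. -/
theorem IsUnitGeodesic.eq_stdCurve [NeZero d] {c : ℝ → Mat d 𝕜} (hc : IsUnitGeodesic c) :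
    ∃ (g : Matrix.SpecialLinearGroup (Fin d) 𝕜) (a : Fin d → ℝ), a ∈ sigmaMod d ∧
      c = stdCurve g a := by
  have hherm : (deriv c 0).IsHermitian := isHermitian_deriv
    (Filter.Eventually.of_forall fun s => (hc.mem s).1.isHermitian)
    (hc.smooth.differentiable (by simp) 0).hasDerivAt
  obtain ⟨g, b, hb, hg0, hgb⟩ := exists_simultaneous_diagonalization (hc.mem 0) hherm
  set a : Fin d → ℝ := fun i => b i / 2 with ha
  have hab : ∀ i, 2 * a i = b i := fun i => by rw [ha]; ring
  have hu := isUnit_det_SL g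
  have huH := isUnit_det_conjTranspose hu
  have hstd : ∀ t, HasDerivAt (stdCurve g a) (stdCurve g a t * ((c 0)⁻¹ * deriv c 0)) t := by
    intro t
    convert hasDerivAt_stdCurve g a t using 1
    rw [← hg0, hgb, stdCurve_eq, sandwich_apply, Matrix.mul_inv_rev]
    calc _ = g.1 * diagMat (fun i => Real.exp (2 * a i * t)) * (g.1ᴴ * (g.1ᴴ)⁻¹) * (g.1⁻¹ * g.1)
          * diagMat b * g.1ᴴ := by simp only [Matrix.mul_assoc]
      _ = g.1 * (diagMat (fun i => Real.exp (2 * a i * t)) * diagMat b) * g.1ᴴ := by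
          rw [Matrix.mul_nonsing_inv _ huH, Matrix.nonsing_inv_mul _ hu]
          simp only [Matrix.mul_assoc, Matrix.mul_one]
      _ = _ := by
          rw [diagMat_mul_diagMat]
          congr 3
          funext i
          rw [Pi.mul_apply, mul_comm, hab]
  have heq : c = stdCurve g a := by
    set M := (c 0)⁻¹ * deriv c 0
    refine ODE_solution_unique_univ (v := fun _ y => y * M) (s := fun _ => Set.univ) (K := ‖M‖₊)
      (t₀ := 0) (fun _ => ?_) (fun t => ⟨hc.hasDerivAt t, trivial⟩) (fun t => ⟨hstd t, trivial⟩) ?_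
    · refine (LipschitzWith.of_dist_le_mul fun x y => ?_).lipschitzOnWith
      rw [dist_eq_norm, dist_eq_norm, ← Matrix.sub_mul, mul_comm]
      exact norm_mul_le _ _
    · rw [stdCurve_zero, act_one, hg0]
  refine ⟨g, a, ⟨⟨fun i j hij => ?_, ?_⟩, ?_⟩, heq⟩
  · exact div_le_div_of_nonneg_right (hb hij) two_pos.le
  · have h1 := (hc.mem 1).2
    rw [heq, stdCurve_eq, Matrix.det_mul, Matrix.det_mul, Matrix.det_conjTranspose, g.2,
      det_diagMat, ← Real.exp_sum] at h1
    simp only [star_one, one_mul, mul_one] at h1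
    have h2 : Real.exp (∑ i, 2 * a i) = 1 := by exact_mod_cast h1
    rw [Real.exp_eq_one_iff, ← Finset.mul_sum] at h2
    linarith
  · have h1 := hc.unit 0
    rw [hgb, ← hg0, metric_mul_conjTranspose hu] at h1
    rw [← h1, Finset.mul_sum, Finset.mul_sum]
    refine Finset.sum_congr rfl fun i _ => ?_
    rw [← hab]
    ring

/-! ### Asymptotic rays -/

/-- Two curves are comparable if their quadratic forms stay within a constant factor of each other
for all positive times. For rays this is equivalent to being asymptotic. -/
def Comparable (c c' : ℝ → Mat d 𝕜) : Prop :=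
  ∃ C : ℝ, ∀ t : ℝ, 0 ≤ t → ∀ u, quadForm (c t) u ≤ C * quadForm (c' t) u ∧
    quadForm (c' t) u ≤ C * quadForm (c t) u

theorem Comparable.refl (c : ℝ → Mat d 𝕜) : Comparable c c := ⟨1, fun t _ u => by simp⟩

theorem Comparable.symm {c c' : ℝ → Mat d 𝕜} (h : Comparable c c') : Comparable c' c := by
  obtain ⟨C, hC⟩ := h
  exact ⟨C, fun t ht u => (hC t ht u).symm⟩

theorem quadForm_nonneg {x : Mat d 𝕜} (hx : x ∈ SymSpace d 𝕜) (u : Fin d → 𝕜) :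
    0 ≤ quadForm x u := hx.1.posSemidef.re_dotProduct_nonneg u

theorem Comparable.trans {c c' c'' : Ray d 𝕜} (h : Comparable c.1 c'.1)
    (h' : Comparable c'.1 c''.1) : Comparable c.1 c''.1 := by
  obtain ⟨C, hC⟩ := h
  obtain ⟨C', hC'⟩ := h'
  refine ⟨|C| * |C'|, fun t ht u => ?_⟩
  have n1 := quadForm_nonneg (c.2.mem t) u
  have n2 := quadForm_nonneg (c'.2.mem t) u
  have n3 := quadForm_nonneg (c''.2.mem t) u
  have hle : ∀ {C x y z C' : ℝ}, 0 ≤ y → 0 ≤ z → x ≤ C * y → y ≤ C' * z → x ≤ |C| * |C'| * z := by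
    intro C x y z C' hy hz h1 h2
    calc x ≤ |C| * y := h1.trans (mul_le_mul_of_nonneg_right (le_abs_self _) hy)
      _ ≤ |C| * (|C'| * z) := mul_le_mul_of_nonneg_left
          (h2.trans (mul_le_mul_of_nonneg_right (le_abs_self _) hz)) (abs_nonneg _)
      _ = _ := by ring
  refine ⟨hle n2 n3 (hC t ht u).1 (hC' t ht u).1, ?_⟩
  rw [mul_comm |C|]
  exact hle n2 n1 (hC' t ht u).2 (hC t ht u).2

theorem Asymptotic.comparable [NeZero d] {c c' : Ray d 𝕜} (h : Asymptotic c c') :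
    Comparable c.1 c'.1 := by
  obtain ⟨C, hC⟩ := h
  refine ⟨Real.exp (2 * (C + 1)), fun t ht u => ?_⟩
  obtain ⟨γ, hγ, hL⟩ := exists_isCurve_curveLength_lt (c.2.mem t) (c'.2.mem t)
    (lt_of_le_of_lt (hC t ht) (lt_add_one C))
  have hexp : Real.exp (2 * curveLength γ) ≤ Real.exp (2 * (C + 1)) :=
    Real.exp_le_exp.2 (by linarith)
  have h1 := hγ.quadForm_comparable u
  exact ⟨h1.2.trans (mul_le_mul_of_nonneg_right hexp (quadForm_nonneg (c'.2.mem t) u)),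
    h1.1.trans (mul_le_mul_of_nonneg_right hexp (quadForm_nonneg (c.2.mem t) u))⟩

theorem conjTranspose_mulVec_inv_mulVec (g : Matrix.SpecialLinearGroup (Fin d) 𝕜) (z : Fin d → 𝕜) :
    (g.1ᴴ) *ᵥ ((g.1ᴴ)⁻¹ *ᵥ z) = z := by
  rw [Matrix.mulVec_mulVec, Matrix.mul_nonsing_inv _ (isUnit_det_conjTranspose (isUnit_det_SL g)),
    Matrix.one_mulVec]

theorem rdist_le_of_comparable [NeZero d] {x y : Mat d 𝕜} (hx : x ∈ SymSpace d 𝕜)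
    (hy : y ∈ SymSpace d 𝕜) {C : ℝ}
    (h : ∀ u, quadForm x u ≤ C * quadForm y u ∧ quadForm y u ≤ C * quadForm x u) :
    rdist x y ≤ √(2 * ∑ _i : Fin d, Real.log C ^ 2) := by
  obtain ⟨a, ha⟩ := exists_isVecDist hx hy
  refine ha.rdist_le.trans (Real.sqrt_le_sqrt ?_)
  refine mul_le_mul_of_nonneg_left (Finset.sum_le_sum fun i _ => ?_) two_pos.le
  obtain ⟨-, g, rfl, rfl⟩ := ha
  obtain ⟨h1, h2⟩ := h ((g.1ᴴ)⁻¹ *ᵥ Pi.single i 1)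
  rw [act_expDiag, act_one, quadForm_mul_conjTranspose, quadForm_mul_diagMat_mul,
    conjTranspose_mulVec_inv_mulVec] at h1 h2
  have e1 : ∑ j, ‖(Pi.single i 1 : Fin d → 𝕜) j‖ ^ 2 = 1 := by
    rw [Finset.sum_eq_single i] <;> simp +contextual
  have e2 : ∑ j, Real.exp (2 * a j) * ‖(Pi.single i 1 : Fin d → 𝕜) j‖ ^ 2 = Real.exp (2 * a i) := by
    rw [Finset.sum_eq_single i] <;> simp +contextual
  rw [e1, e2] at h1 h2
  rw [mul_one] at h2
  have hC : 0 < C := (Real.exp_pos _).trans_le h2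
  have h3 := Real.log_le_log (Real.exp_pos _) h2
  have h4 := Real.log_le_log one_pos h1
  rw [Real.log_exp] at h3
  rw [Real.log_mul hC.ne' (Real.exp_pos _).ne', Real.log_exp, Real.log_one] at h4
  have h5 : |2 * a i| ≤ Real.log C := abs_le.2 ⟨by linarith, h3⟩
  have h6 : (2 * a i) ^ 2 ≤ Real.log C ^ 2 := sq_le_sq' (by linarith) h3
  nlinarith [sq_nonneg (a i)]

theorem Comparable.asymptotic [NeZero d] {c c' : Ray d 𝕜} (h : Comparable c.1 c'.1) :
    Asymptotic c c' := by
  obtain ⟨C, hC⟩ := h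
  exact ⟨_, fun t ht => rdist_le_of_comparable (c.2.mem t) (c'.2.mem t) (hC t ht)⟩

theorem endpoint_eq_iff [NeZero d] {c c' : Ray d 𝕜} :
    c.endpoint = c'.endpoint ↔ Comparable c.1 c'.1 := by
  refine ⟨fun h => ?_, fun h => Quot.sound h.asymptotic⟩
  have h' := Quot.eqvGen_exact h
  clear h
  induction h' with
  | rel c c' h => exact h.comparable
  | refl c => exact Comparable.refl _
  | symm c c' _ ih => exact ih.symm
  | trans c c' c'' _ _ ih ih' => exact ih.trans ih'

theorem quadForm_stdCurve (g : Matrix.SpecialLinearGroup (Fin d) 𝕜) (a : Fin d → ℝ) (t : ℝ)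
    (u : Fin d → 𝕜) :
    quadForm (stdCurve g a t) u = ∑ i, Real.exp (2 * a i * t) * ‖(g.1ᴴ *ᵥ u) i‖ ^ 2 := by
  rw [stdCurve_eq, quadForm_mul_diagMat_mul]

/-- The growth of the two quadratic forms at the vector of the dual frame of `g` with index `i`
shows that `g⁻¹ k` lies in a parabolic subgroup. -/
theorem Comparable.le_of_ne_zero {g k : Matrix.SpecialLinearGroup (Fin d) 𝕜} {a b : Fin d → ℝ}
    (h : Comparable (stdCurve g a) (stdCurve k b)) {i j : Fin d} (hij : (g⁻¹ * k).1 i j ≠ 0) :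
    b j ≤ a i := by
  obtain ⟨C, hC⟩ := h
  set m := (g⁻¹ * k).1 with hm
  have hk : k.1ᴴ = mᴴ * g.1ᴴ := by
    rw [← Matrix.conjTranspose_mul, ← eq_mul_inv_mul g k]
  have key : ∀ t : ℝ, 0 ≤ t →
      Real.exp (2 * b j * t) * ‖m i j‖ ^ 2 ≤ C * Real.exp (2 * a i * t) := by
    intro t ht
    have h1 := (hC t ht ((g.1ᴴ)⁻¹ *ᵥ Pi.single i 1)).2
    rw [quadForm_stdCurve, quadForm_stdCurve, hk, ← Matrix.mulVec_mulVec,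
      conjTranspose_mulVec_inv_mulVec] at h1
    have e2 : ∑ j, Real.exp (2 * a j * t) * ‖(Pi.single i 1 : Fin d → 𝕜) j‖ ^ 2
        = Real.exp (2 * a i * t) := by
      rw [Finset.sum_eq_single i] <;> simp +contextual
    rw [e2] at h1
    refine le_trans ?_ h1
    refine le_trans ?_ (Finset.single_le_sum (fun l _ => by positivity) (Finset.mem_univ j))
    simp [Matrix.mulVec_single]
  by_contra! hlt
  -- At time `t` the inequality bounds `exp (2 (b j - a i) t)`, hence `t`.
  have hpos : 0 < ‖m i j‖ ^ 2 := by positivity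
  set B := C / ‖m i j‖ ^ 2
  have hb : ∀ t : ℝ, 0 ≤ t → 2 * (b j - a i) * t ≤ B := by
    intro t ht
    have h1 : Real.exp (2 * (b j - a i) * t) ≤ B := by
      rw [le_div_iff₀ hpos]
      have h2 := key t ht
      have h3 : Real.exp (2 * b j * t)
          = Real.exp (2 * (b j - a i) * t) * Real.exp (2 * a i * t) := by
        rw [← Real.exp_add]; ring_nf
      rw [h3] at h2
      have h4 := Real.exp_pos (2 * a i * t)
      nlinarith
    have := Real.add_one_le_exp (2 * (b j - a i) * t)
    linarith
  have h5 := hb ((|B| + 1) / (2 * (b j - a i))) (by have : 0 < b j - a i := by linarith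
                                                    positivity)
  rw [mul_div_cancel₀ _ (by linarith)] at h5
  have := le_abs_self B
  linarith

/-- The type of an ideal point is well defined. -/
theorem Comparable.eq_type {g k : Matrix.SpecialLinearGroup (Fin d) 𝕜} {a b : Fin d → ℝ}
    (ha : a ∈ weylChamber d) (hb : b ∈ weylChamber d)
    (h : Comparable (stdCurve g a) (stdCurve k b)) : a = b := by
  obtain ⟨σ, hσ⟩ := exists_perm_forall_ne_zero (isUnit_det_SL (g⁻¹ * k)).ne_zero
  have hle : ∀ i ∈ Finset.univ, b i ≤ a (σ i) := fun i _ => h.le_of_ne_zero (hσ i)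
  have hsum : ∑ i, b i = ∑ i, a (σ i) := by rw [Equiv.sum_comp σ a, ha.2, hb.2]
  exact (antitone_eq_of_comp_perm hb.1 ha.1 σ fun i =>
    (Finset.sum_eq_sum_iff_of_le hle).1 hsum i (Finset.mem_univ i)).symm

/-- Up to a constant factor, multiplication by an element of the parabolic subgroup of `A` does not
make the curve `exp (tA).I` grow faster. -/
theorem quadForm_stdCurve_le {g k : Matrix.SpecialLinearGroup (Fin d) 𝕜} {a : Fin d → ℝ}
    (h : ∀ i j, (g⁻¹ * k).1 i j ≠ 0 → a j ≤ a i) {t : ℝ} (ht : 0 ≤ t) (u : Fin d → 𝕜) :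
    quadForm (stdCurve k a t) u
      ≤ (∑ j, ∑ i, ‖(g⁻¹ * k).1 i j‖ ^ 2) * quadForm (stdCurve g a t) u := by
  set m := (g⁻¹ * k).1 with hm
  have hk : k.1ᴴ = mᴴ * g.1ᴴ := by
    rw [← Matrix.conjTranspose_mul, ← eq_mul_inv_mul g k]
  rw [quadForm_stdCurve, quadForm_stdCurve, hk, ← Matrix.mulVec_mulVec]
  generalize g.1ᴴ *ᵥ u = z
  rw [Finset.sum_mul]
  refine Finset.sum_le_sum fun j _ => ?_
  set s : ℝ := √(Real.exp (2 * a j * t)) with hs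
  have hss : Real.exp (2 * a j * t) = s ^ 2 := (Real.sq_sqrt (Real.exp_pos _).le).symm
  have h1 : ‖(mᴴ *ᵥ z) j‖ ≤ ∑ i, ‖m i j‖ * ‖z i‖ := by
    rw [Matrix.mulVec, dotProduct]
    refine (norm_sum_le _ _).trans (le_of_eq (Finset.sum_congr rfl fun i _ => ?_))
    rw [norm_mul, Matrix.conjTranspose_apply, norm_star]
  have h2 : s * ∑ i, ‖m i j‖ * ‖z i‖
      ≤ ∑ i, ‖m i j‖ * (√(Real.exp (2 * a i * t)) * ‖z i‖) := by
    rw [Finset.mul_sum]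
    refine Finset.sum_le_sum fun i _ => ?_
    by_cases hij : m i j = 0
    · simp [hij]
    · have : s ≤ √(Real.exp (2 * a i * t)) := by
        refine Real.sqrt_le_sqrt (Real.exp_le_exp.2 ?_)
        have := h i j hij
        nlinarith
      calc s * (‖m i j‖ * ‖z i‖) = ‖m i j‖ * (s * ‖z i‖) := by ring
        _ ≤ _ := by gcongr
  calc Real.exp (2 * a j * t) * ‖(mᴴ *ᵥ z) j‖ ^ 2 = (s * ‖(mᴴ *ᵥ z) j‖) ^ 2 := by rw [hss]; ring
    _ ≤ (∑ i, ‖m i j‖ * (√(Real.exp (2 * a i * t)) * ‖z i‖)) ^ 2 := by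
        gcongr
        exact (mul_le_mul_of_nonneg_left h1 (Real.sqrt_nonneg _)).trans h2
    _ ≤ (∑ i, ‖m i j‖ ^ 2) * ∑ i, (√(Real.exp (2 * a i * t)) * ‖z i‖) ^ 2 :=
        Finset.sum_mul_sq_le_sq_mul_sq _ _ _
    _ = _ := by
        congr 1
        refine Finset.sum_congr rfl fun i _ => ?_
        rw [mul_pow, Real.sq_sqrt (Real.exp_pos _).le]

/-! ### The ideal point `ζ(ox)` and its direction -/

theorem lt_of_alpha_pos [d.AtLeastTwo] {a : Fin d → ℝ} (ha : Antitone a) (h : 0 < alpha a)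
    {i : Fin d} (hi : i ≠ 0) : a i < a 0 := by
  have h1 : (1 : Fin d) ≤ i := Fin.one_le_of_ne_zero hi
  have h2 := ha h1
  rw [alpha] at h
  linarith

theorem Zvec_of_ne_zero [d.AtLeastTwo] {i j : Fin d} (hi : i ≠ 0) (hj : j ≠ 0) :
    Zvec d i = Zvec d j := by
  have h : ∀ {i : Fin d}, i ≠ 0 → i.val ≠ 0 := fun hi h0 => hi (Fin.ext h0)
  simp [Zvec, h hi, h hj]

/-- The stabilizer of the ideal point `c_Z (+∞)` contains the stabilizer of the line spanned by the
first basis vector. -/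
theorem comparable_stdCurve_Zvec [d.AtLeastTwo] {g k : Matrix.SpecialLinearGroup (Fin d) 𝕜}
    (h : ∀ i, i ≠ 0 → (g⁻¹ * k).1 i 0 = 0) :
    Comparable (stdCurve g (Zvec d)) (stdCurve k (Zvec d)) := by
  have hZ : Antitone (Zvec d) := Zvec_mem_sigmaMod.1.1
  have hpar : ∀ {m : Mat d 𝕜}, (∀ i, i ≠ 0 → m i 0 = 0) →
      ∀ i j, m i j ≠ 0 → Zvec d j ≤ Zvec d i := by
    intro m hm i j hij
    by_cases hi : i = 0
    · subst hi; exact hZ (Fin.zero_le j)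
    · have hj : j ≠ 0 := fun hj => hij (by rw [hj]; exact hm i hi)
      exact (Zvec_of_ne_zero hj hi).le
  have h' : ∀ i, i ≠ 0 → (k⁻¹ * g).1 i 0 = 0 := by
    have hmul : (k⁻¹ * g).1 * (g⁻¹ * k).1 = 1 := by
      rw [← Matrix.SpecialLinearGroup.coe_mul]
      have : k⁻¹ * g * (g⁻¹ * k) = 1 := by group
      rw [this]; rfl
    have hcol : ∀ i, (k⁻¹ * g).1 i 0 * (g⁻¹ * k).1 0 0 = (1 : Mat d 𝕜) i 0 := by
      intro i
      rw [← hmul, Matrix.mul_apply]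
      symm
      refine Fintype.sum_eq_single (0 : Fin d) fun l hl => ?_
      rw [h l hl, mul_zero]
    have h00 : (g⁻¹ * k).1 0 0 ≠ 0 := by
      intro h0
      have := hcol 0
      rw [h0] at this
      simp at this
    intro i hi
    have := hcol i
    rw [Matrix.one_apply_ne hi] at this
    exact (mul_eq_zero.1 this).resolve_right h00
  set C := ∑ j, ∑ i, ‖(g⁻¹ * k).1 i j‖ ^ 2
  set C' := ∑ j, ∑ i, ‖(k⁻¹ * g).1 i j‖ ^ 2
  have hC : 0 ≤ C := by positivity
  have hC' : 0 ≤ C' := by positivity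
  have hmem := (stdCurve_isUnitGeodesic (𝕜 := 𝕜) · Zvec_mem_sigmaMod (d := d))
  refine ⟨C + C', fun t ht u => ⟨?_, ?_⟩⟩
  · refine (quadForm_stdCurve_le (hpar h') ht u).trans
      (mul_le_mul_of_nonneg_right (by linarith) (quadForm_nonneg ((hmem k).mem t) u))
  · refine (quadForm_stdCurve_le (hpar h) ht u).trans
      (mul_le_mul_of_nonneg_right (by linarith) (quadForm_nonneg ((hmem g).mem t) u))

/-- The ray `g.c_Z`, whose endpoint is of type `ζ`. -/
abbrev zetaRay [d.AtLeastTwo] (g : Matrix.SpecialLinearGroup (Fin d) 𝕜) : Ray d 𝕜 :=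
  stdRay g ⟨Zvec d, Zvec_mem_sigmaMod⟩

theorem vecDist_eq_of_stdCurve [d.AtLeastTwo] {o x : Mat d 𝕜}
    {g : Matrix.SpecialLinearGroup (Fin d) 𝕜} {a : Fin d → ℝ} (ha : a ∈ weylChamber d) {t : ℝ}
    (ht : 0 < t) (ho : stdCurve g a 0 = o) (hx : stdCurve g a t = x) :
    vecDist o x = fun i => t * a i := by
  rw [stdCurve_zero] at ho
  refine IsVecDist.vecDist_eq ⟨⟨fun i j hij => mul_le_mul_of_nonneg_left (ha.1 hij) ht.le, ?_⟩,
    g, ho, hx⟩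
  rw [← Finset.mul_sum, ha.2, mul_zero]

/-- All ideal points of type `ζ` in a common chamber with the endpoint of `ox` are obtained from
frames in which `o` and `x` are diagonal: if `ox` ends at `k.c_A (+∞)` and the chamber is `g.σ_mod`,
then `g⁻¹ k` is in the parabolic subgroup of `A`, which fixes the end point of `c_Z`. -/
theorem IsZetaPoint.exists_frame [d.AtLeastTwo] {o x : Mat d 𝕜} {η : Boundary d 𝕜}
    (h : IsZetaPoint o x η) (hpos : 0 < dAlpha o x) :
    ∃ k : Matrix.SpecialLinearGroup (Fin d) 𝕜, act k.1 1 = o ∧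
      act (k.1 * expDiag (vecDist o x)) 1 = x ∧ η = (zetaRay k).endpoint := by
  obtain ⟨⟨h₀, rfl⟩, ξ, ⟨c, hc0, ⟨t, ht, hct⟩, rfl⟩, g, ⟨a, ha⟩, ⟨b, hb⟩⟩ := h
  obtain ⟨k, a', ha', hck⟩ := c.2.eq_stdCurve
  have hv : vecDist o x = fun i => t * a' i :=
    vecDist_eq_of_stdCurve ha'.1 ht (hck ▸ hc0) (hck ▸ hct)
  have hb' : Zvec d = b.1 :=
    (endpoint_eq_iff.1 hb).eq_type Zvec_mem_sigmaMod.1 b.2.1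
  have hcomp : Comparable (stdCurve g a.1) (stdCurve k a') := by
    have := (endpoint_eq_iff.1 ha).symm
    rwa [hck] at this
  have haa : a.1 = a' := hcomp.eq_type a.2.1 ha'.1
  have hα : 0 < alpha a' := by
    rw [dAlpha, hv, alpha, ← mul_sub] at hpos
    exact (mul_pos_iff_of_pos_left ht).1 hpos
  refine ⟨k, ?_, ?_, ?_⟩
  · rw [← stdCurve_zero k a', ← hck, hc0]
  · rw [hv, ← hct, hck]; rfl
  · refine hb.trans (endpoint_eq_iff.2 ?_)
    change Comparable (stdCurve g b.1) (stdCurve k (Zvec d))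
    rw [← hb']
    refine comparable_stdCurve_Zvec fun i hi => ?_
    by_contra hne
    have h1 := hcomp.le_of_ne_zero hne
    rw [haa] at h1
    exact absurd (lt_of_alpha_pos ha'.1.1 hα hi) (not_lt.2 h1)

/-- Frames in which `o` and `x` are diagonal determine the same ideal point of type `ζ`. -/
theorem zetaRay_endpoint_eq [d.AtLeastTwo] {g k : Matrix.SpecialLinearGroup (Fin d) 𝕜}
    {a : Fin d → ℝ} (ha : Antitone a) (hpos : 0 < alpha a) (h : act g.1 1 = act k.1 1)
    (h' : act (g.1 * expDiag a) 1 = act (k.1 * expDiag a) 1) :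
    (zetaRay g).endpoint = (zetaRay k).endpoint := by
  refine endpoint_eq_iff.2 (comparable_stdCurve_Zvec fun i hi => ?_)
  by_contra hne
  exact (lt_of_alpha_pos ha hpos hi).ne (eq_of_inv_mul_ne_zero h h' hne)

theorem isZetaPoint_of_frame [d.AtLeastTwo] {o x : Mat d 𝕜}
    {k : Matrix.SpecialLinearGroup (Fin d) 𝕜} {a : Fin d → ℝ} (ha : a ∈ weylChamber d)
    (hpos : 0 < alpha a) (ho : act k.1 1 = o) (hx : act (k.1 * expDiag a) 1 = x) :
    IsZetaPoint o x (zetaRay k).endpoint := by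
  -- The ray through `x` belongs to the unit vector `a / r` and passes through `x` at time `r`.
  set r := √(2 * ∑ i, a i ^ 2) with hr
  have hsum : 0 < 2 * ∑ i, a i ^ 2 := by
    refine mul_pos two_pos ((Finset.sum_nonneg fun i _ => sq_nonneg (a i)).lt_of_ne' fun h0 => ?_)
    have h1 := (Finset.sum_eq_zero_iff_of_nonneg fun i _ => sq_nonneg (a i)).1 h0
    have h2 : ∀ i, a i = 0 := fun i => pow_eq_zero_iff two_ne_zero |>.1 (h1 i (Finset.mem_univ i))
    rw [alpha, h2, h2] at hpos
    simp at hpos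
  have hrpos : 0 < r := Real.sqrt_pos.2 hsum
  have hb : (fun i => a i / r) ∈ sigmaMod d := by
    refine ⟨⟨fun i j hij => div_le_div_of_nonneg_right (ha.1 hij) hrpos.le, ?_⟩, ?_⟩
    · rw [← Finset.sum_div, ha.2, zero_div]
    · simp only [div_pow, ← Finset.sum_div]
      rw [mul_div_assoc', hr, Real.sq_sqrt hsum.le, div_self hsum.ne']
  refine ⟨⟨k, rfl⟩, _, ⟨stdRay k ⟨_, hb⟩, ?_, ⟨r, hrpos, ?_⟩, rfl⟩, k, ⟨_, rfl⟩, ⟨_, rfl⟩⟩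
  · change stdCurve k _ 0 = o
    rw [stdCurve_zero, ho]
  · change stdCurve k _ r = x
    rw [← hx, stdCurve]
    congr 3
    funext i
    exact mul_div_cancel₀ _ hrpos.ne'

theorem existsUnique_isZetaPoint [d.AtLeastTwo] {o x : Mat d 𝕜} (ho : o ∈ SymSpace d 𝕜)
    (hx : x ∈ regularSet o) : ∃! η, IsZetaPoint o x η := by
  obtain ⟨ha, k, hko, hkx⟩ := isVecDist_vecDist ho hx.1
  refine ⟨_, isZetaPoint_of_frame ha hx.2 hko hkx, fun η hη => ?_⟩
  obtain ⟨k', hko', hkx', rfl⟩ := hη.exists_frame hx.2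
  exact zetaRay_endpoint_eq ha.1 hx.2 (hko'.trans hko.symm) (hkx'.trans hkx.symm)

theorem zeta_eq_endpoint [d.AtLeastTwo] {o x : Mat d 𝕜} (ho : o ∈ SymSpace d 𝕜)
    (hx : x ∈ regularSet o) {k : Matrix.SpecialLinearGroup (Fin d) 𝕜} (hko : act k.1 1 = o)
    (hkx : act (k.1 * expDiag (vecDist o x)) 1 = x) : zeta o x = (zetaRay k).endpoint := by
  obtain ⟨η, hη, huniq⟩ := existsUnique_isZetaPoint ho hx
  rw [huniq _ (isZetaPoint_of_frame (isVecDist_vecDist ho hx.1).1 hx.2 hko hkx)]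
  exact huniq _ (Classical.epsilon_spec ⟨η, hη⟩)

/-- Asymptotic rays with the same origin are equal: `g⁻¹ k` is unitary and lies in the parabolic
subgroup of `A`, and so does its inverse, so it commutes with `A`. -/
theorem stdCurve_eq_of_comparable {g k : Matrix.SpecialLinearGroup (Fin d) 𝕜} {a b : Fin d → ℝ}
    (ha : a ∈ weylChamber d) (hb : b ∈ weylChamber d) (h : act g.1 1 = act k.1 1)
    (hc : Comparable (stdCurve g a) (stdCurve k b)) : stdCurve g a = stdCurve k b := by
  obtain rfl := hc.eq_type ha hb
  have hmm := inv_mul_mul_conjTranspose h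
  have hm : (k⁻¹ * g).1 = (g⁻¹ * k).1ᴴ := by
    have h1 : (k⁻¹ * g).1 * (g⁻¹ * k).1 = 1 := by
      rw [← Matrix.SpecialLinearGroup.coe_mul]
      have : k⁻¹ * g * (g⁻¹ * k) = 1 := by group
      rw [this]; rfl
    calc (k⁻¹ * g).1 = (k⁻¹ * g).1 * ((g⁻¹ * k).1 * (g⁻¹ * k).1ᴴ) := by rw [hmm, Matrix.mul_one]
      _ = _ := by rw [← Matrix.mul_assoc, h1, Matrix.one_mul]
  have heq : ∀ i j, (g⁻¹ * k).1 i j ≠ 0 → a i = a j := by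
    intro i j hij
    refine le_antisymm (hc.symm.le_of_ne_zero (i := j) (j := i) ?_) (hc.le_of_ne_zero hij)
    rw [hm, Matrix.conjTranspose_apply]
    simpa using hij
  have hgm := eq_mul_inv_mul g k
  generalize (g⁻¹ * k).1 = m at hmm hgm heq
  funext t
  rw [stdCurve_eq, stdCurve_eq, hgm, Matrix.conjTranspose_mul]
  set D : Mat d 𝕜 := diagMat fun i => Real.exp (2 * a i * t) with hD
  have hcomm : m * D = D * m := by
    ext i j
    rw [hD, diagMat, Matrix.diagonal_mul, Matrix.mul_diagonal]
    by_cases hij : m i j = 0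
    · simp [hij]
    · rw [heq i j hij, mul_comm]
  calc g.1 * D * g.1ᴴ = g.1 * (D * (m * mᴴ)) * g.1ᴴ := by rw [hmm, Matrix.mul_one]
    _ = g.1 * (m * D * mᴴ) * g.1ᴴ := by rw [hcomm, Matrix.mul_assoc D]
    _ = _ := by simp only [Matrix.mul_assoc]

theorem isDirection_zetaRay_iff [d.AtLeastTwo] {o v : Mat d 𝕜}
    {k : Matrix.SpecialLinearGroup (Fin d) 𝕜} (hko : act k.1 1 = o) :
    IsDirection o (zetaRay k).endpoint v ↔ v = act k.1 ((2 : ℝ) • diagMat (Zvec d)) := by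
  refine ⟨?_, ?_⟩
  · rintro ⟨c, hc0, hce, rfl⟩
    obtain ⟨g, a, ha, hcg⟩ := c.2.eq_stdCurve
    have hcomp := endpoint_eq_iff.1 hce
    rw [hcg] at hcomp
    have hg : act g.1 1 = act k.1 1 := by rw [hko, ← hc0, hcg, stdCurve_zero]
    rw [hcg, stdCurve_eq_of_comparable ha.1 Zvec_mem_sigmaMod.1 hg hcomp, deriv_stdCurve_zero]
  · rintro rfl
    exact ⟨zetaRay k, by rw [← hko]; exact stdCurve_zero k _, rfl, deriv_stdCurve_zero k _⟩

theorem direction_zetaRay [d.AtLeastTwo] {o : Mat d 𝕜}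
    {k : Matrix.SpecialLinearGroup (Fin d) 𝕜} (hko : act k.1 1 = o) :
    direction o (zetaRay k).endpoint = act k.1 ((2 : ℝ) • diagMat (Zvec d)) :=
  (isDirection_zetaRay_iff hko).1 (Classical.epsilon_spec ⟨_, (isDirection_zetaRay_iff hko).2 rfl⟩)

/-! ### The root pseudodistance along a curve -/

/-- A frame at the identity in which `x` is diagonal. -/
theorem exists_frame [NeZero d] {x : Mat d 𝕜} (hx : x ∈ SymSpace d 𝕜) :
    ∃ k : Matrix.SpecialLinearGroup (Fin d) 𝕜, act k.1 1 = 1 ∧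
      act (k.1 * expDiag (vecDist 1 x)) 1 = x ∧
      x = k.1 * diagMat (fun i => Real.exp (2 * vecDist 1 x i)) * k.1ᴴ := by
  obtain ⟨-, k, h1, h2⟩ := isVecDist_vecDist one_mem_symSpace hx
  exact ⟨k, h1, h2, by rw [← act_expDiag, h2]⟩

theorem antitone_vecDist [NeZero d] {x : Mat d 𝕜} (hx : x ∈ SymSpace d 𝕜) :
    Antitone (vecDist 1 x) := (isVecDist_vecDist one_mem_symSpace hx).1.1

theorem quadForm_one_eq {k : Mat d 𝕜} (hk : act k 1 = 1) (u : Fin d → 𝕜) :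
    quadForm 1 u = ∑ i, ‖(kᴴ *ᵥ u) i‖ ^ 2 := by
  rw [← quadForm_mul_conjTranspose, ← act_one, hk]

/-- The first component `a₁ - a₂` of the vector-valued distance is governed by the ratio of the
two largest eigenvalues, and hence by ratios of values of the quadratic form: test with the top
eigenvector of `x` and a vector orthogonal to it in the span of two top eigenvectors of `γ t`. -/
theorem IsCurve.dAlpha_sub_curveLength_le [d.AtLeastTwo] {γ : ℝ → Mat d 𝕜} {x y : Mat d 𝕜}
    (h : IsCurve γ x y) {t : ℝ} (ht : t ∈ Set.Icc (0 : ℝ) 1) :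
    dAlpha 1 x - curveLength γ ≤ dAlpha 1 (γ t) := by
  have hx : x ∈ SymSpace d 𝕜 := h.source ▸ h.mem 0 (by simp)
  have hy := h.mem t ht
  obtain ⟨k, hk1, -, hkx⟩ := exists_frame hx
  obtain ⟨m, hm1, -, hmy⟩ := exists_frame hy
  have ha := antitone_vecDist hx
  have hb := antitone_vecDist hy
  set a := vecDist 1 x with ha_def
  set b := vecDist 1 (γ t) with hb_def
  have h01 : (0 : Fin d) ≠ 1 := by
    obtain ⟨n, rfl⟩ : ∃ n, d = n + 2 := ⟨d - 2, by have := Nat.AtLeastTwo.prop (n := d); omega⟩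
    exact zero_ne_one
  have hkk : k.1ᴴ * k.1 = 1 := mul_eq_one_comm.1 ((act_one k.1).symm.trans hk1)
  have hmm : m.1ᴴ * m.1 = 1 := mul_eq_one_comm.1 ((act_one m.1).symm.trans hm1)
  set u : Fin d → 𝕜 := k.1 *ᵥ Pi.single 0 1 with hu_def
  have hku : k.1ᴴ *ᵥ u = Pi.single 0 1 := by
    rw [hu_def, Matrix.mulVec_mulVec, hkk, Matrix.one_mulVec]
  -- `w = m z` is in the span of two top eigenvectors of `γ t` and orthogonal to `u`.
  obtain ⟨z, hz0, hz, hzk⟩ : ∃ z : Fin d → 𝕜, z ≠ 0 ∧ (∀ i, i ≠ 0 → i ≠ 1 → z i = 0) ∧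
      (k.1ᴴ *ᵥ (m.1 *ᵥ z)) 0 = 0 := by
    set n := k.1ᴴ * m.1
    have hn : ∀ p q : 𝕜, (n *ᵥ (Pi.single 0 p + Pi.single 1 q)) 0 = n 0 0 * p + n 0 1 * q := by
      intro p q
      rw [Matrix.mulVec_add, Pi.add_apply, Matrix.mulVec_single, Matrix.mulVec_single]
      simp
    have hsupp : ∀ p q : 𝕜, ∀ i : Fin d, i ≠ 0 → i ≠ 1 →
        (Pi.single 0 p + Pi.single 1 q : Fin d → 𝕜) i = 0 := by
      intro p q i h0 h1
      simp [h0, h1]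
    by_cases hn1 : n 0 1 = 0
    · refine ⟨Pi.single 0 0 + Pi.single 1 1, fun h0 => ?_, hsupp 0 1, ?_⟩
      · have := congrFun h0 1
        simp at this
      · rw [Matrix.mulVec_mulVec, hn, hn1]
        simp
    · refine ⟨Pi.single 0 (n 0 1) + Pi.single 1 (-n 0 0), fun h0 => ?_, hsupp _ _, ?_⟩
      · have := congrFun h0 0
        simp [h01] at this
        exact hn1 this
      · rw [Matrix.mulVec_mulVec, hn]
        ring
  set w : Fin d → 𝕜 := m.1 *ᵥ z with hw_def
  have hmw : m.1ᴴ *ᵥ w = z := by rw [hw_def, Matrix.mulVec_mulVec, hmm, Matrix.one_mulVec]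
  have hw0 : w ≠ 0 := by
    intro h0; rw [h0, Matrix.mulVec_zero] at hmw; exact hz0 hmw.symm
  have hu0 : u ≠ 0 := by
    intro h0
    rw [h0, Matrix.mulVec_zero] at hku
    have := congrFun hku 0
    simp at this
  have e1 : quadForm x u = Real.exp (2 * a 0) := by
    rw [hkx, quadForm_mul_diagMat_mul, hku, Finset.sum_eq_single 0] <;> simp +contextual
  have e1' : quadForm 1 u = 1 := by
    rw [quadForm_one_eq hk1, hku, Finset.sum_eq_single 0] <;> simp +contextual
  have e2 : quadForm (γ t) u ≤ Real.exp (2 * b 0) := by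
    rw [← mul_one (Real.exp _), ← e1', quadForm_one_eq hm1]
    conv_lhs => rw [hmy, quadForm_mul_diagMat_mul]
    rw [Finset.mul_sum]
    gcongr with i
    exact hb (Fin.zero_le i)
  have e3 : quadForm x w ≤ Real.exp (2 * a 1) * quadForm 1 w := by
    rw [quadForm_one_eq hk1, Finset.mul_sum]
    conv_lhs => rw [hkx, quadForm_mul_diagMat_mul]
    refine Finset.sum_le_sum fun i _ => ?_
    by_cases hi : i = 0
    · rw [hi, hzk]; simp
    · gcongr
      exact ha (Fin.one_le_of_ne_zero hi)
  have e4 : Real.exp (2 * b 1) * quadForm 1 w ≤ quadForm (γ t) w := by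
    rw [quadForm_one_eq hm1, Finset.mul_sum]
    conv_rhs => rw [hmy, quadForm_mul_diagMat_mul]
    refine Finset.sum_le_sum fun i _ => ?_
    rw [hmw]
    by_cases hi : i ≠ 0 ∧ i ≠ 1
    · rw [hz i hi.1 hi.2]; simp
    · gcongr
      have hi1 : i ≤ 1 := by
        rw [not_and_or, not_not, not_not] at hi
        rcases hi with rfl | rfl
        · exact Fin.zero_le 1
        · exact le_rfl
      exact hb hi1
  have hW : 0 < quadForm (1 : Mat d 𝕜) w := quadForm_pos Matrix.PosDef.one hw0
  have key := h.quadForm_mul_quadForm_le hu0 hw0 ht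
  rw [e1] at key
  have h5 : Real.exp (2 * b 1) * Real.exp (2 * a 0) * quadForm (1 : Mat d 𝕜) w
      ≤ Real.exp (2 * curveLength γ) * (Real.exp (2 * b 0) * Real.exp (2 * a 1))
        * quadForm (1 : Mat d 𝕜) w := by
    calc _ = (Real.exp (2 * b 1) * quadForm 1 w) * Real.exp (2 * a 0) := by ring
      _ ≤ quadForm (γ t) w * Real.exp (2 * a 0) := by gcongr
      _ ≤ _ := key
      _ ≤ Real.exp (2 * curveLength γ) *
          (Real.exp (2 * b 0) * (Real.exp (2 * a 1) * quadForm 1 w)) := by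
        have := (quadForm_pos hx.1 hw0).le
        gcongr
      _ = _ := by ring
  have h6 := le_of_mul_le_mul_right h5 hW
  rw [← Real.exp_add, ← Real.exp_add, ← Real.exp_add, Real.exp_le_exp] at h6
  rw [dAlpha, dAlpha, alpha, alpha]
  linarith

/-! ### The derivative of the top eigenprojection -/

variable (d 𝕜) in
/-- The projection to the first coordinate axis. -/
def firstProj [NeZero d] : Mat d 𝕜 := diagMat (Pi.single 0 1)

theorem metric_diagMat_exp (a : Fin d → ℝ) {V : Mat d 𝕜} (hV : V.IsHermitian) :
    metric (diagMat fun i => Real.exp (2 * a i)) V V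
      = 1 / 2 * ∑ i, ∑ j, ‖V i j‖ ^ 2 / (Real.exp (2 * a i) * Real.exp (2 * a j)) := by
  have hinv : (diagMat (fun i => Real.exp (2 * a i)) : Mat d 𝕜)⁻¹
      = diagMat fun i => (Real.exp (2 * a i))⁻¹ := by
    refine Matrix.inv_eq_right_inv ?_
    rw [diagMat_mul_diagMat, ← diagMat_one]
    congr 1
    funext i
    exact mul_inv_cancel₀ (Real.exp_pos _).ne'
  rw [metric, hinv, Matrix.trace, map_sum]
  congr 1
  refine Finset.sum_congr rfl fun i _ => ?_
  rw [Matrix.diag_apply, Matrix.mul_apply, map_sum]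
  refine Finset.sum_congr rfl fun j _ => ?_
  simp only [diagMat, Matrix.mul_diagonal, Matrix.diagonal_mul]
  have h1 : V j i = star (V i j) := (hV.apply j i).symm
  have h2 : V i j * star (V i j) = ((‖V i j‖ ^ 2 : ℝ) : 𝕜) := by
    rw [RCLike.star_def, RCLike.mul_conj]; norm_cast
  have h3 : (((Real.exp (2 * a i))⁻¹ : ℝ) : 𝕜) * V i j * (((Real.exp (2 * a j))⁻¹ : ℝ) : 𝕜) * V j i
      = ((‖V i j‖ ^ 2 / (Real.exp (2 * a i) * Real.exp (2 * a j)) : ℝ) : 𝕜) := by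
    rw [h1, div_eq_mul_inv, mul_inv, RCLike.ofReal_mul, RCLike.ofReal_mul, ← h2]
    ring
  rw [h3, RCLike.ofReal_re]

theorem metric_one_self {V : Mat d 𝕜} (hV : V.IsHermitian) :
    metric 1 V V = 1 / 2 * ∑ i, ∑ j, ‖V i j‖ ^ 2 := by
  have := metric_diagMat_exp (0 : Fin d → ℝ) hV
  simpa [diagMat_one, show (fun _ : Fin d => (1 : ℝ)) = 1 from rfl] using this

theorem four_mul_sinh_sq_mul_exp_le {p q S : ℝ} (hS : 0 ≤ S) (h : S ≤ p - q) :
    4 * Real.sinh S ^ 2 * (Real.exp (2 * q) * Real.exp (2 * p))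
      ≤ (Real.exp (2 * p) - Real.exp (2 * q)) ^ 2 := by
  have h1 : Real.exp (2 * p) - Real.exp (2 * q)
      = 2 * Real.sinh (p - q) * (Real.exp p * Real.exp q) := by
    rw [Real.sinh_eq, ← Real.exp_add]
    have e1 : Real.exp (2 * p) = Real.exp (p - q) * Real.exp (p + q) := by
      rw [← Real.exp_add]; ring_nf
    have e2 : Real.exp (2 * q) = Real.exp (-(p - q)) * Real.exp (p + q) := by
      rw [← Real.exp_add]; ring_nf
    rw [e1, e2]; ring
  have h2 : Real.exp (2 * q) * Real.exp (2 * p) = (Real.exp p * Real.exp q) ^ 2 := by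
    rw [← Real.exp_add, ← Real.exp_add, sq, ← Real.exp_add]; ring_nf
  have h3 : Real.sinh S ^ 2 ≤ Real.sinh (p - q) ^ 2 :=
    pow_le_pow_left₀ (Real.sinh_nonneg_iff.2 hS) (Real.sinh_le_sinh.2 h) 2
  rw [h1, h2]
  calc _ ≤ 4 * Real.sinh (p - q) ^ 2 * (Real.exp p * Real.exp q) ^ 2 := by gcongr
    _ = _ := by ring

/-- The infinitesimal estimate at a diagonal matrix. The entries of the derivative `Q` of the
eigenprojection outside of the first row and column vanish, and `Q j 0 = V j 0 / (l 0 - l j)` for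
the eigenvalues `l i = exp (2 a i)`. -/
theorem metric_deriv_firstProj_le [d.AtLeastTwo] {a : Fin d → ℝ} (ha : Antitone a) {S : ℝ}
    (hS : 0 ≤ S) (hSa : S ≤ alpha a) {V Q : Mat d 𝕜} (hV : V.IsHermitian) (hQ : Q.IsHermitian)
    (hQP : Q * firstProj d 𝕜 + firstProj d 𝕜 * Q = Q)
    (hder : Q * diagMat (fun i => Real.exp (2 * a i)) * firstProj d 𝕜
      = (1 - firstProj d 𝕜) * V * firstProj d 𝕜
        + (1 - firstProj d 𝕜) * diagMat (fun i => Real.exp (2 * a i)) * Q) :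
    4 * Real.sinh S ^ 2 * metric 1 Q Q
      ≤ metric (diagMat fun i => Real.exp (2 * a i)) V V := by
  have hE : (1 : Mat d 𝕜) - firstProj d 𝕜 = diagMat (1 - Pi.single 0 1) := by
    rw [← diagMat_one, firstProj, diagMat, diagMat, diagMat, Matrix.diagonal_sub]
    congr 1
    funext i
    simp
  have hzero : ∀ i j, i ≠ 0 → j ≠ 0 → Q i j = 0 := by
    intro i j hi hj
    have := congrFun (congrFun hQP i) j
    rw [Matrix.add_apply, firstProj, diagMat, Matrix.mul_diagonal, Matrix.diagonal_mul] at this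
    simpa [hi, hj, eq_comm] using this
  have h00 : Q 0 0 = 0 := by
    have := congrFun (congrFun hQP 0) 0
    rw [Matrix.add_apply, firstProj, diagMat, Matrix.mul_diagonal, Matrix.diagonal_mul] at this
    simpa using this
  have hj0 : ∀ j, j ≠ 0 →
      (((Real.exp (2 * a 0) - Real.exp (2 * a j) : ℝ)) : 𝕜) * Q j 0 = V j 0 := by
    intro j hj
    have := congrFun (congrFun hder j) 0
    rw [Matrix.add_apply, hE, firstProj, diagMat_mul_diagMat] at this
    simp only [diagMat, Matrix.mul_diagonal, Matrix.diagonal_mul] at this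
    simp [hj] at this
    push_cast
    linear_combination this
  have hcol : ∀ j, j ≠ 0 → 4 * Real.sinh S ^ 2 * ‖Q j 0‖ ^ 2
      ≤ ‖V j 0‖ ^ 2 / (Real.exp (2 * a j) * Real.exp (2 * a 0)) := by
    intro j hj
    have haj : S ≤ a 0 - a j := by
      have := ha (Fin.one_le_of_ne_zero hj)
      rw [alpha] at hSa
      linarith
    rw [le_div_iff₀ (by positivity), ← hj0 j hj, norm_mul, mul_pow, RCLike.norm_ofReal, sq_abs]
    have := four_mul_sinh_sq_mul_exp_le hS haj
    calc _ = 4 * Real.sinh S ^ 2 * (Real.exp (2 * a j) * Real.exp (2 * a 0)) * ‖Q j 0‖ ^ 2 := by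
          ring
      _ ≤ _ := by gcongr
  have hswap : ∀ {M : Mat d 𝕜}, M.IsHermitian → ∀ i j, ‖M i j‖ = ‖M j i‖ := by
    intro M hM i j
    rw [← hM.apply i j, norm_star]
  rw [metric_one_self hQ, metric_diagMat_exp a hV, mul_left_comm, Finset.mul_sum]
  gcongr with i
  rw [Finset.mul_sum]
  gcongr with j
  by_cases hi : i = 0
  · subst hi
    by_cases hj : j = 0
    · subst hj
      rw [h00]
      rw [norm_zero, zero_pow two_ne_zero, mul_zero]
      positivity
    · rw [hswap hQ, hswap hV, mul_comm (Real.exp _)]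
      exact hcol j hj
  · by_cases hj : j = 0
    · subst hj; exact hcol i hi
    · rw [hzero i j hi hj]
      rw [norm_zero, zero_pow two_ne_zero, mul_zero]
      positivity

/-! ### Curves on the unit sphere -/

theorem metric_one_eq (v w : Mat d 𝕜) : metric 1 v w = 1 / 2 * RCLike.re (v * w).trace := by
  rw [metric, inv_one, Matrix.one_mul, Matrix.mul_one]

theorem metric_one_comm (v w : Mat d 𝕜) : metric 1 v w = metric 1 w v := by
  rw [metric_one_eq, metric_one_eq, Matrix.trace_mul_comm]

/-- `metric 1 v`, as a linear functional. -/
def metricCLM (v : Mat d 𝕜) : Mat d 𝕜 →L[ℝ] ℝ :=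
  LinearMap.toContinuousLinearMap
    { toFun := fun w => metric 1 v w
      map_add' := fun X Y => by simp [metric_one_eq, mul_add]
      map_smul' := fun r X => by
        simp [metric_one_eq, RCLike.smul_re, mul_left_comm] }

theorem metricCLM_apply (v w : Mat d 𝕜) : metricCLM v w = metric 1 v w := rfl

theorem metric_one_add_smul (v w x : Mat d 𝕜) (s : ℝ) :
    metric 1 x (v + s • w) = metric 1 x v + s * metric 1 x w := by
  simp only [← metricCLM_apply, map_add, map_smul, smul_eq_mul]

theorem metric_one_add_smul_self (v w : Mat d 𝕜) (s : ℝ) :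
    metric 1 (v + s • w) (v + s • w)
      = metric 1 v v + 2 * s * metric 1 v w + s ^ 2 * metric 1 w w := by
  rw [metric_one_add_smul, metric_one_comm _ v, metric_one_comm _ w, metric_one_add_smul,
    metric_one_add_smul, metric_one_comm w v]
  ring

theorem isHermitian_add_smul {v w : Mat d 𝕜} (hv : v.IsHermitian) (hw : w.IsHermitian) (s : ℝ) :
    (v + s • w).IsHermitian := by
  refine hv.add ?_
  rw [Matrix.IsHermitian, Matrix.conjTranspose_smul, hw.eq]
  simp

theorem metric_one_sq_le {v w : Mat d 𝕜} (hv : v.IsHermitian) (hw : w.IsHermitian) :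
    metric 1 v w ^ 2 ≤ metric 1 v v * metric 1 w w := by
  have h : ∀ s : ℝ, 0 ≤ metric 1 w w * (s * s) + 2 * metric 1 v w * s + metric 1 v v := by
    intro s
    have h1 := metric_one_add_smul_self v w s
    have h2 : 0 ≤ metric 1 (v + s • w) (v + s • w) := by
      rw [metric_one_self (isHermitian_add_smul hv hw s)]
      positivity
    nlinarith
  have := discrim_le_zero h
  rw [discrim] at this
  nlinarith

/-- The angle between the end points of a curve on the unit sphere is at most its length. The
function `arccos` is not differentiable at `±1`, so that the argument is scaled by `r < 1`. -/
theorem IsCurve.arccos_metric_le {γ : ℝ → Mat d 𝕜} {x y : Mat d 𝕜} (h : IsCurve γ x y) {κ : ℝ}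
    (hκ : 0 ≤ κ) {v v' : ℝ → Mat d 𝕜} (hc : ContinuousOn v (Set.Icc 0 1))
    (hv : ∀ t ∈ Set.Icc (0 : ℝ) 1, (v t).IsHermitian)
    (hunit : ∀ t ∈ Set.Icc (0 : ℝ) 1, metric 1 (v t) (v t) = 1)
    (hd : ∀ t ∈ Set.Ioo (0 : ℝ) 1, HasDerivAt v (v' t) t)
    (hle : ∀ t ∈ Set.Ioo (0 : ℝ) 1, metric 1 (v' t) (v' t) ≤ (κ * speed γ t) ^ 2) :
    Real.arccos (metric 1 (v 0) (v 1)) ≤ κ * curveLength γ := by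
  set f : ℝ → ℝ := fun t => metricCLM (v 0) (v t) with hf
  have hw := hv 0 (by simp)
  have hw1 := hunit 0 (by simp)
  have hfc : ContinuousOn f (Set.Icc 0 1) := (metricCLM (v 0)).continuous.comp_continuousOn hc
  have hf1 : ∀ t ∈ Set.Icc (0 : ℝ) 1, f t ^ 2 ≤ 1 := by
    intro t ht
    have := metric_one_sq_le hw (hv t ht)
    rwa [hw1, hunit t ht, one_mul] at this
  have hfd : ∀ t ∈ Set.Ioo (0 : ℝ) 1, HasDerivAt f (metric 1 (v 0) (v' t)) t := fun t ht =>
    (metricCLM (v 0)).hasFDerivAt.comp_hasDerivAt t (hd t ht)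
  have hv' : ∀ t ∈ Set.Ioo (0 : ℝ) 1, (v' t).IsHermitian := fun t ht =>
    SLSym.isHermitian_deriv
      (by filter_upwards [Icc_mem_nhds ht.1 ht.2] with s hs using hv s hs) (hd t ht)
  -- The velocity is orthogonal to `v t`, so that only the component of `v 0` orthogonal to `v t`
  -- contributes to the derivative of `f`; its norm is `√(1 - f t ^ 2)`.
  have horth : ∀ t ∈ Set.Ioo (0 : ℝ) 1, metric 1 (v t) (v' t) = 0 := by
    intro t ht
    have h1 : HasDerivAt (fun s => metric 1 (v s) (v s)) (2 * metric 1 (v t) (v' t)) t := by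
      have h2 : HasDerivAt (fun s => v s * v s) (v' t * v t + v t * v' t) t :=
        (hd t ht).mul (hd t ht)
      have h3 := (metricCLM (1 : Mat d 𝕜)).hasFDerivAt.comp_hasDerivAt t h2
      have h4 : ∀ p q : Mat d 𝕜, metric 1 1 (p * q) = metric 1 p q := fun p q => by
        rw [metric_one_eq, metric_one_eq, Matrix.one_mul]
      have h5 : (fun s => metric 1 (v s) (v s)) = metricCLM (1 : Mat d 𝕜) ∘ fun s => v s * v s := by
        funext s
        exact (h4 _ _).symm
      rw [h5]
      refine h3.congr_deriv ?_
      refine (map_add (metricCLM (1 : Mat d 𝕜)) _ _).trans ?_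
      rw [metricCLM_apply, metricCLM_apply, h4, h4, metric_one_comm (v' t)]
      ring
    have h6 : HasDerivAt (fun s => metric 1 (v s) (v s)) 0 t :=
      (hasDerivAt_const t (1 : ℝ)).congr_of_eventuallyEq (by
        filter_upwards [Icc_mem_nhds ht.1 ht.2] with s hs using hunit s hs)
    linarith [h1.unique h6]
  have hbound : ∀ t ∈ Set.Ioo (0 : ℝ) 1,
      metric 1 (v 0) (v' t) ^ 2 ≤ (1 - f t ^ 2) * (κ * speed γ t) ^ 2 := by
    intro t ht
    have ht' := Set.Ioo_subset_Icc_self ht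
    have h1 := metric_one_sq_le (isHermitian_add_smul hw (hv t ht') (-f t)) (hv' t ht)
    have h2 : metric 1 (v 0 + (-f t) • v t) (v' t) = metric 1 (v 0) (v' t) := by
      rw [metric_one_comm, metric_one_add_smul, metric_one_comm _ (v t), horth t ht,
        metric_one_comm]
      ring
    have h3 : metric 1 (v 0 + (-f t) • v t) (v 0 + (-f t) • v t) = 1 - f t ^ 2 := by
      rw [metric_one_add_smul_self, hw1, hunit t ht',
        show metric 1 (v 0) (v t) = f t from rfl]
      ring
    rw [h2, h3] at h1
    exact h1.trans (mul_le_mul_of_nonneg_left (hle t ht) (by linarith [hf1 t ht']))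
  have hr : ∀ r ∈ Set.Ioo (0 : ℝ) 1, Real.arccos (r * f 1) - Real.arccos r ≤ κ * curveLength γ := by
    intro r hr
    have hrf : ∀ t ∈ Set.Icc (0 : ℝ) 1, (r * f t) ^ 2 < 1 := by
      intro t ht
      have := hf1 t ht
      have hr2 : r ^ 2 < 1 := by nlinarith [hr.1, hr.2]
      rw [mul_pow]
      nlinarith [sq_nonneg (f t), sq_nonneg r]
    have key := h.sub_le_mul_curveLength (f := fun t => Real.arccos (r * f t))
      (f' := fun t => -(1 / √(1 - (r * f t) ^ 2)) * (r * metric 1 (v 0) (v' t))) hκ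
      (Real.continuous_arccos.comp_continuousOn (continuousOn_const.mul hfc))
      (fun t ht => by
        have h1 := hrf t (Set.Ioo_subset_Icc_self ht)
        have h2 : r * f t ≠ -1 := fun h0 => by rw [h0] at h1; norm_num at h1
        have h3 : r * f t ≠ 1 := fun h0 => by rw [h0] at h1; norm_num at h1
        exact HasDerivAt.comp (h₂ := Real.arccos) (h := fun t => r * f t) t
          (Real.hasDerivAt_arccos h2 h3) ((hfd t ht).const_mul r))
      (fun t ht => by
        have ht' := Set.Ioo_subset_Icc_self ht
        have h1 : 0 < 1 - (r * f t) ^ 2 := by linarith [hrf t ht']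
        have h2 : 0 < √(1 - (r * f t) ^ 2) := Real.sqrt_pos.2 h1
        have hks : 0 ≤ κ * speed γ t := mul_nonneg hκ (speed_nonneg _ _)
        have h3 : |r * metric 1 (v 0) (v' t)| ≤ κ * speed γ t * √(1 - (r * f t) ^ 2) := by
          refine abs_le_of_sq_le_sq ?_ (by positivity)
          rw [mul_pow, mul_pow _ (√_), Real.sq_sqrt h1.le]
          have hr2 : r ^ 2 ≤ 1 := by nlinarith [hr.1, hr.2]
          calc r ^ 2 * metric 1 (v 0) (v' t) ^ 2
              ≤ r ^ 2 * ((1 - f t ^ 2) * (κ * speed γ t) ^ 2) := by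
                gcongr
                exact hbound t ht
            _ = (r ^ 2 - (r * f t) ^ 2) * (κ * speed γ t) ^ 2 := by ring
            _ ≤ (1 - (r * f t) ^ 2) * (κ * speed γ t) ^ 2 := by gcongr
            _ = _ := by ring
        rw [neg_mul, ← mul_neg, one_div, inv_mul_le_iff₀ h2, mul_comm (√_)]
        exact (neg_le_abs _).trans h3)
      (t := 1) (by simp)
    have hf0 : f 0 = 1 := hw1
    simpa [hf0] using key
  have hlim : Filter.Tendsto (fun r : ℝ => Real.arccos (r * f 1) - Real.arccos r)
      (nhdsWithin 1 (Set.Iio 1)) (nhds (Real.arccos (1 * f 1) - Real.arccos 1)) := by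
    refine Filter.Tendsto.mono_left ?_ nhdsWithin_le_nhds
    have : Continuous fun r : ℝ => Real.arccos (r * f 1) - Real.arccos r := by
      have := Real.continuous_arccos
      fun_prop
    exact this.tendsto 1
  rw [Real.arccos_one, one_mul, sub_zero] at hlim
  refine le_of_tendsto hlim ?_
  filter_upwards [Ioo_mem_nhdsLT (zero_lt_one' ℝ)] with r hr' using hr r hr'

/-! ### The top eigenprojection is a smooth function of the matrix -/

theorem contDiff_entry {n : WithTop ℕ∞} (i j : Fin d) :
    ContDiff ℝ n (fun X : Mat d 𝕜 => X i j) :=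
  (LinearMap.toContinuousLinearMap (Matrix.entryLinearMap ℝ 𝕜 i j)).contDiff

theorem contDiff_of_entries {E : Type*} [NormedAddCommGroup E] [NormedSpace ℝ E]
    {n : WithTop ℕ∞} {f : E → Mat d 𝕜} (h : ∀ i j, ContDiff ℝ n fun x => f x i j) :
    ContDiff ℝ n f := by
  have hf : f = fun x => ∑ i, ∑ j,
      LinearMap.toContinuousLinearMap (Matrix.singleLinearMap ℝ i j) (f x i j) := by
    funext x
    exact Matrix.matrix_eq_sum_single (f x)
  have hs : ∀ i j, ContDiff ℝ n fun y : 𝕜 =>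
      (LinearMap.toContinuousLinearMap (Matrix.singleLinearMap ℝ i j) y : Mat d 𝕜) :=
    fun i j => ContinuousLinearMap.contDiff _
  rw [hf]
  exact ContDiff.sum fun i _ => ContDiff.sum fun j _ => (hs i j).comp (h i j)

theorem contDiff_det {n : WithTop ℕ∞} : ContDiff ℝ n (fun X : Mat d 𝕜 => X.det) := by
  simp only [Matrix.det_apply']
  exact ContDiff.sum fun σ _ => contDiff_const.mul (contDiff_prod fun i _ => contDiff_entry _ _)

theorem contDiff_adjugate {n : WithTop ℕ∞} : ContDiff ℝ n (fun X : Mat d 𝕜 => X.adjugate) := by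
  refine contDiff_of_entries fun i j => ?_
  simp only [Matrix.adjugate_apply]
  refine contDiff_det.comp (contDiff_of_entries fun k l => ?_)
  by_cases hk : k = j
  · subst hk
    simp only [Matrix.updateRow_self]
    exact contDiff_const
  · simp only [Matrix.updateRow_ne hk]
    exact contDiff_entry k l

theorem contDiff_smul_one_sub {n : WithTop ℕ∞} :
    ContDiff ℝ n (fun v : Mat d 𝕜 × ℝ => v.2 • (1 : Mat d 𝕜) - v.1) :=
  (contDiff_snd.smul contDiff_const).sub contDiff_fst

theorem contDiffAt_adjugate_smul_one_sub {n : WithTop ℕ∞} {ℓ : Mat d 𝕜 → ℝ} {x₀ : Mat d 𝕜}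
    (h : ContDiffAt ℝ n ℓ x₀) :
    ContDiffAt ℝ n (fun x => (ℓ x • (1 : Mat d 𝕜) - x).adjugate) x₀ := by
  have h1 : ContDiffAt ℝ n (fun x => ((x, ℓ x) : Mat d 𝕜 × ℝ)) x₀ := contDiffAt_id.prodMk h
  have h2 : ContDiffAt ℝ n (fun v : Mat d 𝕜 × ℝ => (v.2 • (1 : Mat d 𝕜) - v.1).adjugate)
      ((fun x => ((x, ℓ x) : Mat d 𝕜 × ℝ)) x₀) :=
    (contDiff_adjugate.comp contDiff_smul_one_sub).contDiffAt
  exact ContDiffAt.comp (f := fun x => ((x, ℓ x) : Mat d 𝕜 × ℝ))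
    (g := fun v : Mat d 𝕜 × ℝ => (v.2 • (1 : Mat d 𝕜) - v.1).adjugate) x₀ h2 h1

/-- `P` is the projection to the first eigenline in a frame in which `x` is diagonal. -/
def IsTopProj [NeZero d] (x P : Mat d 𝕜) : Prop :=
  ∃ k : Matrix.SpecialLinearGroup (Fin d) 𝕜, act k.1 1 = 1 ∧
    act (k.1 * expDiag (vecDist 1 x)) 1 = x ∧ P = act k.1 (firstProj d 𝕜)

/-- The projection to an eigenline of `x` for the largest eigenvalue. -/
def topProj [NeZero d] (x : Mat d 𝕜) : Mat d 𝕜 := Classical.epsilon (IsTopProj x)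

theorem isTopProj_topProj [NeZero d] {x : Mat d 𝕜} (hx : x ∈ SymSpace d 𝕜) :
    IsTopProj x (topProj x) := by
  obtain ⟨k, h1, h2, -⟩ := exists_frame hx
  exact Classical.epsilon_spec ⟨_, k, h1, h2, rfl⟩

/-- The largest eigenvalue of `x`. -/
def topEigenvalue [NeZero d] (x : Mat d 𝕜) : ℝ := Real.exp (2 * vecDist 1 x 0)

theorem sub_eq_act {k : Mat d 𝕜} (hk : act k 1 = 1) (l : ℝ) (a : Fin d → ℝ) :
    l • (1 : Mat d 𝕜) - k * diagMat a * kᴴ = act k (diagMat fun i => l - a i) := by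
  have h1 : (diagMat (fun i => l - a i) : Mat d 𝕜) = l • (1 : Mat d 𝕜) - diagMat a := by
    ext i j
    by_cases h : i = j <;> simp [diagMat, h, RCLike.real_smul_eq_coe_mul]
  rw [h1, act, Matrix.mul_sub, Matrix.sub_mul, Matrix.mul_smul, Matrix.smul_mul, Matrix.mul_one,
    ← act_one, hk]

theorem det_act {k : Matrix.SpecialLinearGroup (Fin d) 𝕜} (x : Mat d 𝕜) :
    (act k.1 x).det = x.det := by
  rw [act, Matrix.det_mul, Matrix.det_mul, Matrix.det_conjTranspose, k.2]
  simp

theorem det_smul_one_sub {k : Matrix.SpecialLinearGroup (Fin d) 𝕜} (hk : act k.1 1 = 1) (l : ℝ)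
    (a : Fin d → ℝ) :
    RCLike.re (l • (1 : Mat d 𝕜) - k.1 * diagMat a * k.1ᴴ).det = ∏ i, (l - a i) := by
  rw [sub_eq_act hk, det_act, det_diagMat, RCLike.ofReal_re]

theorem adjugate_smul_one_sub [NeZero d] {k : Matrix.SpecialLinearGroup (Fin d) 𝕜}
    (hk : act k.1 1 = 1) (a : Fin d → ℝ) :
    (a 0 • (1 : Mat d 𝕜) - k.1 * diagMat a * k.1ᴴ).adjugate
      = (∏ i ∈ Finset.univ.erase 0, (a 0 - a i)) • act k.1 (firstProj d 𝕜) := by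
  have hkk : k.1 * k.1ᴴ = 1 := (act_one k.1).symm.trans hk
  have hkk' : k.1ᴴ * k.1 = 1 := mul_eq_one_comm.1 hkk
  have hadj : k.1.adjugate = k.1ᴴ := by
    rw [← Matrix.inv_eq_right_inv hkk, Matrix.inv_def, k.2, Ring.inverse_one, one_smul]
  have hadj' : (k.1ᴴ).adjugate = k.1 := by
    rw [← Matrix.adjugate_conjTranspose, hadj, Matrix.conjTranspose_conjTranspose]
  have hD : (diagMat (fun i => a 0 - a i) : Mat d 𝕜).adjugate
      = (∏ i ∈ Finset.univ.erase 0, (a 0 - a i)) • firstProj d 𝕜 := by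
    rw [diagMat, Matrix.adjugate_diagonal]
    ext i j
    by_cases hij : i = j
    · subst hij
      by_cases hi : i = 0
      · subst hi
        simp [firstProj, diagMat, RCLike.real_smul_eq_coe_mul]
      · have h0 : ∏ j ∈ Finset.univ.erase i, ((a 0 - a j : ℝ) : 𝕜) = 0 :=
          Finset.prod_eq_zero (i := 0) (by simp [Ne.symm hi]) (by simp)
        rw [Matrix.diagonal_apply_eq, h0]
        simp [firstProj, diagMat, hi]
    · simp [firstProj, diagMat, hij]
  rw [sub_eq_act hk, act, Matrix.adjugate_mul_distrib, Matrix.adjugate_mul_distrib, hadj, hadj', hD,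
    act, ← Matrix.mul_assoc]
  simp

theorem trace_act_firstProj [NeZero d] {k : Mat d 𝕜} (hk : act k 1 = 1) :
    (act k (firstProj d 𝕜)).trace = 1 := by
  have hkk' : kᴴ * k = 1 := mul_eq_one_comm.1 ((act_one k).symm.trans hk)
  rw [act, Matrix.trace_mul_comm, ← Matrix.mul_assoc, hkk', Matrix.one_mul, firstProj, diagMat,
    Matrix.trace_diagonal, Finset.sum_eq_single 0] <;> simp +contextual

theorem abs_quadForm_le_norm (M : Mat d 𝕜) (u : Fin d → 𝕜) :
    |quadForm M u| ≤ ‖M‖ * ∑ i, ‖u i‖ ^ 2 := by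
  have h1 : |quadForm M u| ≤ ∑ i, ∑ j, ‖M i j‖ * (‖u i‖ * ‖u j‖) := by
    refine (RCLike.abs_re_le_norm _).trans ?_
    rw [dotProduct]
    refine (norm_sum_le _ _).trans (Finset.sum_le_sum fun i _ => ?_)
    rw [norm_mul, Pi.star_apply, norm_star, Matrix.mulVec, dotProduct]
    refine (mul_le_mul_of_nonneg_left (norm_sum_le _ _) (norm_nonneg _)).trans (le_of_eq ?_)
    rw [Finset.mul_sum]
    refine Finset.sum_congr rfl fun j _ => ?_
    rw [norm_mul]
    ring
  refine h1.trans (abs_le_of_sq_le_sq' ?_ (by positivity)).2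
  simp only [← Fintype.sum_prod_type']
  refine (Finset.sum_mul_sq_le_sq_mul_sq _ _ _).trans (le_of_eq ?_)
  rw [mul_pow, Matrix.frobenius_norm_def, ← Real.sqrt_eq_rpow, Real.sq_sqrt (by positivity)]
  simp only [mul_pow, Fintype.sum_prod_type, ← Finset.mul_sum, ← Finset.sum_mul, Real.rpow_two]
  ring

theorem topEigenvalue_le_add_norm [NeZero d] {x y : Mat d 𝕜} (hx : x ∈ SymSpace d 𝕜)
    (hy : y ∈ SymSpace d 𝕜) : topEigenvalue x ≤ topEigenvalue y + ‖x - y‖ := by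
  obtain ⟨k, hk1, -, hkx⟩ := exists_frame hx
  obtain ⟨m, hm1, -, hmy⟩ := exists_frame hy
  have hkk : k.1ᴴ * k.1 = 1 := mul_eq_one_comm.1 ((act_one k.1).symm.trans hk1)
  set u : Fin d → 𝕜 := k.1 *ᵥ Pi.single 0 1 with hu_def
  have hku : k.1ᴴ *ᵥ u = Pi.single 0 1 := by
    rw [hu_def, Matrix.mulVec_mulVec, hkk, Matrix.one_mulVec]
  have e1 : quadForm x u = topEigenvalue x := by
    conv_lhs => rw [hkx]
    rw [quadForm_mul_diagMat_mul, hku, Finset.sum_eq_single 0] <;>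
      simp +contextual [topEigenvalue]
  have e1' : quadForm 1 u = 1 := by
    rw [quadForm_one_eq hk1, hku, Finset.sum_eq_single 0] <;> simp +contextual
  have e2 : quadForm y u ≤ topEigenvalue y := by
    rw [← mul_one (topEigenvalue y), ← e1', quadForm_one_eq hm1]
    conv_lhs => rw [hmy, quadForm_mul_diagMat_mul]
    rw [Finset.mul_sum, topEigenvalue]
    gcongr with i
    exact antitone_vecDist hy (Fin.zero_le i)
  have e3 := abs_quadForm_le_norm (x - y) u
  have e4 : ∑ i, ‖u i‖ ^ 2 = 1 := by
    rw [← e1', quadForm_one_eq (act_one (1 : Mat d 𝕜) |>.trans (by simp))]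
    simp
  have e5 : quadForm (x - y) u = quadForm x u - quadForm y u := map_sub (quadFormCLM u) x y
  rw [e4, mul_one, e5, e1] at e3
  linarith [(abs_le.1 e3).2]

theorem prod_topEigenvalue_sub_ne_zero [d.AtLeastTwo] {x₀ : Mat d 𝕜} (hx₀ : x₀ ∈ regularSet 1) :
    ∏ i ∈ Finset.univ.erase 0,
      (Real.exp (2 * vecDist 1 x₀ 0) - Real.exp (2 * vecDist 1 x₀ i)) ≠ 0 := by
  refine Finset.prod_ne_zero_iff.2 fun i hi => ?_
  have := lt_of_alpha_pos (antitone_vecDist hx₀.1) hx₀.2 (Finset.ne_of_mem_erase hi)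
  exact (sub_pos.2 (Real.exp_lt_exp.2 (by linarith))).ne'

/-- A simple top eigenvalue is a smooth function of the matrix, by the implicit function theorem for
the equation `det (l - x) = 0`. -/
theorem exists_contDiffAt_eq_topEigenvalue [d.AtLeastTwo] {x₀ : Mat d 𝕜}
    (hx₀ : x₀ ∈ regularSet 1) :
    ∃ ℓ : Mat d 𝕜 → ℝ, ContDiffAt ℝ ω ℓ x₀ ∧
      ∀ᶠ x in nhds x₀, x ∈ SymSpace d 𝕜 → ℓ x = topEigenvalue x := by
  set f : Mat d 𝕜 × ℝ → ℝ := fun v => RCLike.re (v.2 • (1 : Mat d 𝕜) - v.1).det with hf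
  set u₀ : Mat d 𝕜 × ℝ := (x₀, topEigenvalue x₀) with hu₀
  have hfC : ContDiff ℝ ω f :=
    (RCLike.reCLM (K := 𝕜)).contDiff.comp (contDiff_det.comp contDiff_smul_one_sub)
  have hfu : ∀ x ∈ SymSpace d 𝕜, f (x, topEigenvalue x) = 0 := by
    intro x hx
    obtain ⟨k, hk1, -, hkx⟩ := exists_frame hx
    have h1 := det_smul_one_sub hk1 (topEigenvalue x) fun i => Real.exp (2 * vecDist 1 x i)
    rw [← hkx] at h1
    exact h1.trans (Finset.prod_eq_zero (Finset.mem_univ 0) (sub_self _))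
  obtain ⟨k₀, hk1, -, hkx⟩ := exists_frame hx₀.1
  set l : Fin d → ℝ := fun i => Real.exp (2 * vecDist 1 x₀ i) with hl
  have hl0 : topEigenvalue x₀ = l 0 := rfl
  set β : ℝ := ∏ i ∈ Finset.univ.erase 0, (l 0 - l i) with hβ
  have hβ0 : β ≠ 0 := prod_topEigenvalue_sub_ne_zero hx₀
  have hcd : ContDiffAt ℝ ω f u₀ := hfC.contDiffAt
  have hpart : HasDerivAt (fun t => f (x₀, t)) β (topEigenvalue x₀) := by
    have h1 : (fun t => f (x₀, t)) = fun t => (t - l 0) * ∏ i ∈ Finset.univ.erase 0, (t - l i) := by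
      funext t
      rw [hf]
      simp only
      rw [hkx, det_smul_one_sub hk1, Finset.mul_prod_erase _ (fun i => t - l i) (Finset.mem_univ 0)]
    rw [h1, hl0]
    have h2 : DifferentiableAt ℝ (fun t => ∏ i ∈ Finset.univ.erase 0, (t - l i)) (l 0) := by
      fun_prop
    have h3 := ((hasDerivAt_id (l 0)).sub_const (l 0)).mul h2.hasDerivAt
    exact h3.congr_deriv (by simp [hβ])
  have hfd : fderiv ℝ f u₀ ∘L .inr ℝ (Mat d 𝕜) ℝ
      = ((ContinuousLinearEquiv.unitsEquivAut ℝ (Units.mk0 β hβ0) : ℝ ≃L[ℝ] ℝ) : ℝ →L[ℝ] ℝ) := by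
    refine ContinuousLinearMap.ext_ring ?_
    have h1 : HasFDerivAt f (fderiv ℝ f u₀) u₀ :=
      (hcd.differentiableAt (by simp)).hasFDerivAt
    have h2 : HasDerivAt (fun t : ℝ => ((x₀, t) : Mat d 𝕜 × ℝ)) (0, 1) (topEigenvalue x₀) :=
      (hasDerivAt_const _ x₀).prodMk (hasDerivAt_id _)
    have h3 := (h1.comp_hasDerivAt (topEigenvalue x₀) h2).unique hpart
    refine Eq.trans (show _ = _ from h3) ?_
    simp
  have hinv : (fderiv ℝ f u₀ ∘L .inr ℝ (Mat d 𝕜) ℝ).IsInvertible := ⟨_, hfd.symm⟩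
  have hω : (ω : WithTop ℕ∞) ≠ 0 := by simp
  have hev := hcd.eventually_apply_eq_iff_implicitFunction hω hinv
  refine ⟨_, hcd.contDiffAt_implicitFunction hω hinv, ?_⟩
  -- The top eigenvalue depends continuously on the matrix, so it is the implicit function.
  obtain ⟨ε, hε, h⟩ := Metric.eventually_nhds_iff.1 hev
  refine Metric.eventually_nhds_iff.2 ⟨ε, hε, fun x hx hxS => ?_⟩
  have h1 := topEigenvalue_le_add_norm hxS hx₀.1
  have h2 := topEigenvalue_le_add_norm hx₀.1 hxS
  rw [dist_eq_norm] at hx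
  rw [norm_sub_rev] at h2
  have h3 : dist ((x, topEigenvalue x) : Mat d 𝕜 × ℝ) u₀ < ε := by
    rw [Prod.dist_eq, max_lt_iff, hu₀, dist_eq_norm, Real.dist_eq]
    exact ⟨hx, (abs_le.2 ⟨by linarith, by linarith⟩).trans_lt hx⟩
  exact (h h3).1 ((hfu x hxS).trans (hfu x₀ hx₀.1).symm)

/-- Near a matrix with a simple top eigenvalue `l` the eigenprojection is
`adj (l - x) / tr (adj (l - x))`. -/
theorem exists_contDiffOn_eq_topProj [d.AtLeastTwo] {x₀ : Mat d 𝕜} (hx₀ : x₀ ∈ regularSet 1) :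
    ∃ (U : Set (Mat d 𝕜)) (F : Mat d 𝕜 → Mat d 𝕜), IsOpen U ∧ x₀ ∈ U ∧ ContDiffOn ℝ ∞ F U ∧
      ∀ x ∈ SymSpace d 𝕜 ∩ U, F x = topProj x := by
  obtain ⟨ℓ, hℓC, hev⟩ := exists_contDiffAt_eq_topEigenvalue hx₀
  have hℓ0 := hev.self_of_nhds hx₀.1
  obtain ⟨k₀, hk1, -, hkx⟩ := exists_frame hx₀.1
  set l : Fin d → ℝ := fun i => Real.exp (2 * vecDist 1 x₀ i) with hl
  have hl0 : topEigenvalue x₀ = l 0 := rfl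
  have hβ0 : ∏ i ∈ Finset.univ.erase 0, (l 0 - l i) ≠ 0 := prod_topEigenvalue_sub_ne_zero hx₀
  set A : Mat d 𝕜 → Mat d 𝕜 := fun x => (ℓ x • (1 : Mat d 𝕜) - x).adjugate with hA
  have hAC : ContDiffAt ℝ ω A x₀ := contDiffAt_adjugate_smul_one_sub hℓC
  have hAeq : ∀ x ∈ SymSpace d 𝕜, ℓ x = topEigenvalue x →
      ∃ b : ℝ, A x = b • topProj x ∧ (A x).trace = (b : 𝕜) := by
    intro x hx hlx
    obtain ⟨k, hk1, hk2, hP⟩ := isTopProj_topProj hx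
    rw [act_expDiag] at hk2
    have h1 := adjugate_smul_one_sub hk1 (fun i => Real.exp (2 * vecDist 1 x i))
    rw [hk2, ← hP] at h1
    rw [show Real.exp (2 * vecDist 1 x 0) = ℓ x from hlx.symm] at h1
    refine ⟨_, h1, ?_⟩
    rw [show A x = _ from h1, hP, Matrix.trace_smul, trace_act_firstProj hk1,
      RCLike.real_smul_eq_coe_mul, mul_one]
  have htr0 : (A x₀).trace ≠ 0 := by
    rw [hA]
    simp only
    rw [hℓ0, hl0, hkx, adjugate_smul_one_sub hk1, Matrix.trace_smul, trace_act_firstProj hk1,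
      RCLike.real_smul_eq_coe_mul, mul_one]
    exact_mod_cast hβ0
  have htrC : ContDiffAt ℝ ω (fun x => (A x).trace) x₀ :=
    (LinearMap.toContinuousLinearMap (Matrix.traceLinearMap (Fin d) ℝ 𝕜)).contDiff.contDiffAt.comp
      x₀ hAC
  have hFC : ContDiffAt ℝ ω (fun x => ((A x).trace)⁻¹ • A x) x₀ := (htrC.inv htr0).smul hAC
  have hne : ∀ᶠ x in nhds x₀, (A x).trace ≠ 0 := htrC.continuousAt.eventually_ne htr0
  obtain ⟨U, hU, hUo, hUx⟩ := eventually_nhds_iff.1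
    ((hFC.eventually (by simp)).and (hev.and hne))
  refine ⟨U, fun x => ((A x).trace)⁻¹ • A x, hUo, hUx, ?_, ?_⟩
  · exact fun x hx => ((hU x hx).1.of_le le_top).contDiffWithinAt
  · rintro x ⟨hxS, hxU⟩
    obtain ⟨b, h1, h2⟩ := hAeq x hxS ((hU x hxU).2.1 hxS)
    have h3 := (hU x hxU).2.2
    simp only
    rw [h2] at h3 ⊢
    rw [h1, ← RCLike.ofReal_inv]
    have hb : b ≠ 0 := fun h0 => h3 (by rw [h0]; simp)
    ext i j
    simp only [Matrix.smul_apply, smul_eq_mul, RCLike.real_smul_eq_coe_mul]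
    rw [← mul_assoc, ← RCLike.ofReal_mul, inv_mul_cancel₀ hb]
    simp

/-! ### The directions of the ideal points of type `ζ` -/

/-- The tangent vector at the identity of type `ζ` with top eigenprojection `P`. For the projection
to the first coordinate axis it is `2Z`. -/
def zetaVec [d.AtLeastTwo] (P : Mat d 𝕜) : Mat d 𝕜 :=
  (2 * alpha (Zvec d)) • P - (2 / √(2 * d * (d - 1))) • (1 : Mat d 𝕜)

theorem alpha_Zvec [d.AtLeastTwo] : alpha (Zvec d) = d / √(2 * d * (d - 1)) := by
  obtain ⟨n, rfl⟩ : ∃ n, d = n + 2 := ⟨d - 2, by have := Nat.AtLeastTwo.prop (n := d); omega⟩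
  simp [alpha, Zvec]
  ring

theorem alpha_Zvec_nonneg [d.AtLeastTwo] : 0 ≤ alpha (Zvec d) := by
  rw [alpha_Zvec]; positivity

theorem zetaVec_act_firstProj [d.AtLeastTwo] {k : Mat d 𝕜} (hk : act k 1 = 1) :
    zetaVec (act k (firstProj d 𝕜)) = act k ((2 : ℝ) • diagMat (Zvec d)) := by
  have h1 : ((2 : ℝ) • diagMat (Zvec d) : Mat d 𝕜)
      = (2 * alpha (Zvec d)) • firstProj d 𝕜 - (2 / √(2 * d * (d - 1))) • (1 : Mat d 𝕜) := by
    have h2 : ∀ i, 2 * Zvec d i = 2 * alpha (Zvec d) * (Pi.single 0 1 : Fin d → ℝ) i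
        - 2 / √(2 * d * (d - 1)) := by
      intro i
      rw [alpha_Zvec]
      by_cases hi : i = 0
      · subst hi
        simp [Zvec]
        ring
      · have : i.val ≠ 0 := fun h0 => hi (Fin.ext h0)
        simp [Zvec, hi, this]
        ring
    ext i j
    by_cases hij : i = j
    · subst hij
      have := congrArg (fun r : ℝ => (r : 𝕜)) (h2 i)
      simpa [diagMat, firstProj, RCLike.real_smul_eq_coe_mul] using this
    · simp [diagMat, firstProj, hij]
  rw [h1, zetaVec]
  conv_lhs => rw [← hk]
  simp only [act, Matrix.mul_sub, Matrix.sub_mul, Matrix.mul_smul, Matrix.smul_mul]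

theorem vecDist_act [NeZero d] (g : Matrix.SpecialLinearGroup (Fin d) 𝕜) {x : Mat d 𝕜}
    (hx : x ∈ SymSpace d 𝕜) : vecDist (act g.1 1) (act g.1 x) = vecDist 1 x := by
  obtain ⟨ha, k, hk1, hk2⟩ := isVecDist_vecDist one_mem_symSpace hx
  refine IsVecDist.vecDist_eq ⟨ha, g * k, ?_, ?_⟩
  · rw [Matrix.SpecialLinearGroup.coe_mul, act_mul, hk1]
  · rw [Matrix.SpecialLinearGroup.coe_mul, Matrix.mul_assoc, act_mul, hk2]

theorem act_mem_regularSet_iff [d.AtLeastTwo] (g : Matrix.SpecialLinearGroup (Fin d) 𝕜)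
    {x : Mat d 𝕜} (hx : x ∈ SymSpace d 𝕜) :
    act g.1 x ∈ regularSet (act g.1 1) ↔ x ∈ regularSet 1 := by
  simp only [regularSet, Set.mem_ofPred_eq, dAlpha, vecDist_act g hx, hx, act_mem_symSpace g hx]

theorem exists_zeta_eq [d.AtLeastTwo] (g : Matrix.SpecialLinearGroup (Fin d) 𝕜) {x : Mat d 𝕜}
    (hx : x ∈ regularSet 1) : ∃ k : Matrix.SpecialLinearGroup (Fin d) 𝕜,
      act k.1 1 = act g.1 1 ∧ zeta (act g.1 1) (act g.1 x) = (zetaRay k).endpoint ∧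
      act k.1 ((2 : ℝ) • diagMat (Zvec d)) = act g.1 (zetaVec (topProj x)) := by
  obtain ⟨k, hk1, hk2, hP⟩ := isTopProj_topProj hx.1
  have h1 : act (g * k).1 1 = act g.1 1 := by
    rw [Matrix.SpecialLinearGroup.coe_mul, act_mul, hk1]
  refine ⟨g * k, h1, zeta_eq_endpoint (act_mem_symSpace g one_mem_symSpace)
    ((act_mem_regularSet_iff g hx.1).2 hx) h1 ?_, ?_⟩
  · rw [vecDist_act g hx.1, Matrix.SpecialLinearGroup.coe_mul, Matrix.mul_assoc, act_mul, hk2]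
  · rw [hP, zetaVec_act_firstProj hk1, Matrix.SpecialLinearGroup.coe_mul, act_mul]

theorem direction_zeta_act [d.AtLeastTwo] (g : Matrix.SpecialLinearGroup (Fin d) 𝕜) {x : Mat d 𝕜}
    (hx : x ∈ regularSet 1) :
    direction (act g.1 1) (zeta (act g.1 1) (act g.1 x)) = act g.1 (zetaVec (topProj x)) := by
  obtain ⟨k, hk1, hk2, hk3⟩ := exists_zeta_eq g hx
  rw [hk2, direction_zetaRay hk1, hk3]

theorem exists_act_one_eq [NeZero d] {o : Mat d 𝕜} (ho : o ∈ SymSpace d 𝕜) :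
    ∃ g : Matrix.SpecialLinearGroup (Fin d) 𝕜, act g.1 1 = o := by
  obtain ⟨-, -, g, hg, -⟩ := exists_isVecDist ho ho
  exact ⟨g, hg⟩

theorem exists_mem_regularSet_one [d.AtLeastTwo] (g : Matrix.SpecialLinearGroup (Fin d) 𝕜)
    {x : Mat d 𝕜} (hx : x ∈ regularSet (act g.1 1)) :
    act (g⁻¹).1 x ∈ regularSet 1 ∧ act g.1 (act (g⁻¹).1 x) = x := by
  have h1 := act_act_inv g x
  refine ⟨(act_mem_regularSet_iff g (act_mem_symSpace _ hx.1)).1 ?_, h1⟩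
  rwa [h1]

theorem smoothBetween_direction [d.AtLeastTwo] {o : Mat d 𝕜} (ho : o ∈ SymSpace d 𝕜) :
    SmoothBetween (fun x => direction o (zeta o x)) (regularSet o) (orbitZ o) := by
  obtain ⟨g, rfl⟩ := exists_act_one_eq ho
  refine ⟨fun x hx => ?_, fun x hx => ?_⟩
  · obtain ⟨h1, h2⟩ := exists_mem_regularSet_one g hx
    rw [← h2]
    obtain ⟨k, hk1, hk2, hk3⟩ := exists_zeta_eq g h1
    exact ⟨k, hk1, by simp only [hk2, direction_zetaRay hk1]⟩
  · obtain ⟨h1, h2⟩ := exists_mem_regularSet_one g hx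
    obtain ⟨U, F, hU, hxU, hF, hFeq⟩ := exists_contDiffOn_eq_topProj h1
    have hact : ∀ h : Mat d 𝕜, ContDiff ℝ ∞ (fun y : Mat d 𝕜 => act h y) := fun h =>
      (contDiff_const.mul contDiff_id).mul contDiff_const
    refine ⟨(fun y => act (g⁻¹).1 y) ⁻¹' U, fun y => act g.1 (zetaVec (F (act (g⁻¹).1 y))),
      hU.preimage (hact _).continuous, hxU, ?_, ?_⟩
    · have h3 : ContDiffOn ℝ ∞ (fun y : Mat d 𝕜 => F (act (g⁻¹).1 y))
          ((fun y => act (g⁻¹).1 y) ⁻¹' U) :=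
        hF.comp (hact _).contDiffOn fun y hy => hy
      have h4 : ContDiff ℝ ∞ (fun P : Mat d 𝕜 =>
          (2 * alpha (Zvec d)) • P - (2 / √(2 * d * (d - 1))) • (1 : Mat d 𝕜)) :=
        (contDiff_id.const_smul _).sub contDiff_const
      exact (hact g.1).comp_contDiffOn (h4.comp_contDiffOn h3)
    · rintro y ⟨hy, hyU⟩
      obtain ⟨h3, h4⟩ := exists_mem_regularSet_one g hy
      have h5 := direction_zeta_act g h3
      rw [h4] at h5
      simp only
      rw [h5, hFeq _ ⟨h3.1, hyU⟩]

/-! ### The angle estimate -/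

theorem act_isHermitian {v : Mat d 𝕜} (hv : v.IsHermitian) (g : Mat d 𝕜) :
    (act g v).IsHermitian := Matrix.isHermitian_mul_mul_conjTranspose g hv

theorem act_mul_act {k : Mat d 𝕜} (hk : act k 1 = 1) (x y : Mat d 𝕜) :
    act k x * act k y = act k (x * y) := by
  have hkk : kᴴ * k = 1 := mul_eq_one_comm.1 ((act_one k).symm.trans hk)
  simp only [act]
  calc _ = k * x * (kᴴ * k) * y * kᴴ := by simp only [Matrix.mul_assoc]
    _ = _ := by rw [hkk, Matrix.mul_one]; simp only [Matrix.mul_assoc]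

theorem firstProj_mul_self [NeZero d] : firstProj d 𝕜 * firstProj d 𝕜 = firstProj d 𝕜 := by
  rw [firstProj, diagMat_mul_diagMat]
  congr 1
  funext i
  by_cases hi : i = 0
  · subst hi; simp
  · simp [hi]

theorem topProj_isHermitian [NeZero d] {x : Mat d 𝕜} (hx : x ∈ SymSpace d 𝕜) :
    (topProj x).IsHermitian := by
  obtain ⟨k, -, -, hP⟩ := isTopProj_topProj hx
  rw [hP]
  exact act_isHermitian (diagMat_isHermitian _) _

theorem topProj_mul_self [NeZero d] {x : Mat d 𝕜} (hx : x ∈ SymSpace d 𝕜) :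
    topProj x * topProj x = topProj x := by
  obtain ⟨k, hk1, -, hP⟩ := isTopProj_topProj hx
  rw [hP, act_mul_act hk1, firstProj_mul_self]

theorem one_sub_topProj_mul_mul [NeZero d] {x : Mat d 𝕜} (hx : x ∈ SymSpace d 𝕜) :
    (1 - topProj x) * x * topProj x = 0 := by
  obtain ⟨k, hk1, hk2, hP⟩ := isTopProj_topProj hx
  rw [act_expDiag] at hk2
  set Λ : Mat d 𝕜 := diagMat fun i => Real.exp (2 * vecDist 1 x i)
  have hk2' : act k.1 Λ = x := hk2
  have h1 : act k.1 Λ * act k.1 (firstProj d 𝕜) = act k.1 (firstProj d 𝕜) * act k.1 Λ := by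
    rw [act_mul_act hk1, act_mul_act hk1, firstProj, diagMat_mul_diagMat, diagMat_mul_diagMat,
      mul_comm]
  rw [hk2', ← hP] at h1
  rw [Matrix.mul_assoc, h1, Matrix.sub_mul, Matrix.one_mul, ← Matrix.mul_assoc,
    topProj_mul_self hx, sub_self]

theorem zetaVec_isHermitian [d.AtLeastTwo] {P : Mat d 𝕜} (hP : P.IsHermitian) :
    (zetaVec P).IsHermitian := by
  rw [Matrix.IsHermitian, zetaVec, Matrix.conjTranspose_sub, Matrix.conjTranspose_smul,
    Matrix.conjTranspose_smul, hP.eq]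
  simp

theorem metric_zetaVec_topProj [d.AtLeastTwo] {x : Mat d 𝕜} (hx : x ∈ SymSpace d 𝕜) :
    metric 1 (zetaVec (topProj x)) (zetaVec (topProj x)) = 1 := by
  obtain ⟨k, hk1, -, hP⟩ := isTopProj_topProj hx
  have h2 : ((2 : ℝ) • diagMat (Zvec d) : Mat d 𝕜) = diagMat fun i => 2 * Zvec d i := by
    ext i j
    by_cases h : i = j <;> simp [diagMat, h, RCLike.real_smul_eq_coe_mul]
  have h3 := metric_act (isUnit_det_SL k) 1 ((2 : ℝ) • diagMat (Zvec d) : Mat d 𝕜)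
    ((2 : ℝ) • diagMat (Zvec d))
  rw [hk1] at h3
  rw [hP, zetaVec_act_firstProj hk1, h3, h2, metric_one_diagMat]
  refine Eq.trans ?_ (Zvec_mem_sigmaMod (d := d)).2
  rw [Finset.mul_sum, Finset.mul_sum]
  exact Finset.sum_congr rfl fun i _ => by ring

/-- The infinitesimal estimate: the derivative `Q` of the top eigenprojection in the direction `V`
is bounded by `‖V‖ / sinh S` where the root pseudodistance is at least `S`. -/
theorem metric_deriv_topProj_le [d.AtLeastTwo] {x : Mat d 𝕜} (hx : x ∈ SymSpace d 𝕜) {S : ℝ}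
    (hS : 0 ≤ S) (hSx : S ≤ dAlpha 1 x) {V Q : Mat d 𝕜} (hV : V.IsHermitian) (hQ : Q.IsHermitian)
    (hQP : Q * topProj x + topProj x * Q = Q)
    (hder : Q * x * topProj x
      = (1 - topProj x) * V * topProj x + (1 - topProj x) * x * Q) :
    4 * Real.sinh S ^ 2 * metric 1 Q Q ≤ metric x V V := by
  obtain ⟨k, hk1, hk2, hP⟩ := isTopProj_topProj hx
  rw [act_expDiag] at hk2
  set Λ : Mat d 𝕜 := diagMat fun i => Real.exp (2 * vecDist 1 x i) with hΛ
  have hx' : x = act k.1 Λ := hk2.symm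
  obtain ⟨V', rfl⟩ : ∃ V', V = act k.1 V' := ⟨_, (act_act_inv k V).symm⟩
  obtain ⟨Q', rfl⟩ : ∃ Q', Q = act k.1 Q' := ⟨_, (act_act_inv k Q).symm⟩
  have hV' : V'.IsHermitian := by
    have := act_isHermitian hV (k⁻¹).1
    rwa [act_inv_act] at this
  have hQ' : Q'.IsHermitian := by
    have := act_isHermitian hQ (k⁻¹).1
    rwa [act_inv_act] at this
  have hadd : ∀ y z : Mat d 𝕜, act k.1 y + act k.1 z = act k.1 (y + z) := fun y z => by
    simp only [act, Matrix.mul_add, Matrix.add_mul]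
  have hsub : ∀ y : Mat d 𝕜, 1 - act k.1 y = act k.1 (1 - y) := fun y => by
    conv_lhs => rw [← hk1]
    simp only [act, Matrix.mul_sub, Matrix.sub_mul]
  have hmul := act_mul_act hk1
  have h1 : metric 1 (act k.1 Q') (act k.1 Q') = metric 1 Q' Q' := by
    have := metric_act (isUnit_det_SL k) 1 Q' Q'
    rwa [hk1] at this
  have h2 : metric x (act k.1 V') (act k.1 V') = metric Λ V' V' := by
    rw [hx', metric_act (isUnit_det_SL k)]
  rw [h1, h2]
  rw [hP, hmul, hmul, hadd] at hQP
  rw [hP, hsub, hmul, hmul] at hder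
  rw [hx'] at hder
  simp only [hmul, hadd] at hder
  exact metric_deriv_firstProj_le (antitone_vecDist hx) hS hSx hV' hQ'
    (act_injective k hQP) (act_injective k hder)

/-- The direction of `ζ(ox)` moves at most at the speed `α (Z) / sinh S` times that of `x`. -/
theorem IsCurve.arccos_metric_zetaVec_le [d.AtLeastTwo] {γ : ℝ → Mat d 𝕜} {x y : Mat d 𝕜}
    (h : IsCurve γ x y) {S : ℝ} (hS : 0 < S)
    (hSγ : ∀ t ∈ Set.Icc (0 : ℝ) 1, S ≤ dAlpha 1 (γ t)) :
    Real.arccos (metric 1 (zetaVec (topProj x)) (zetaVec (topProj y)))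
      ≤ alpha (Zvec d) / Real.sinh S * curveLength γ := by
  have hsinh : 0 < Real.sinh S := Real.sinh_pos_iff.2 hS
  have hreg : ∀ t ∈ Set.Icc (0 : ℝ) 1, γ t ∈ regularSet 1 := fun t ht =>
    ⟨h.mem t ht, hS.trans_le (hSγ t ht)⟩
  set p : ℝ → Mat d 𝕜 := fun t => topProj (γ t) with hp
  -- Locally, `p` is the restriction of a continuously differentiable function.
  have hloc : ∀ t ∈ Set.Icc (0 : ℝ) 1, ∃ F : ℝ → Mat d 𝕜, DifferentiableAt ℝ F t ∧
      ∀ᶠ s in nhds t, s ∈ Set.Icc (0 : ℝ) 1 → p s = F s := by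
    intro t ht
    obtain ⟨U, F, hU, htU, hF, hFeq⟩ := exists_contDiffOn_eq_topProj (hreg t ht)
    have h1 : DifferentiableAt ℝ F (γ t) :=
      (hF.contDiffAt (hU.mem_nhds htU)).differentiableAt (by simp)
    refine ⟨F ∘ γ, h1.comp t (h.hasDerivAt t).differentiableAt, ?_⟩
    have h2 := (h.hasDerivAt t).continuousAt.preimage_mem_nhds (hU.mem_nhds htU)
    filter_upwards [h2] with s hs hs'
    exact (hFeq _ ⟨h.mem s hs', hs⟩).symm
  have hpc : ContinuousOn p (Set.Icc 0 1) := by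
    intro t ht
    obtain ⟨F, hF, hFeq⟩ := hloc t ht
    refine hF.continuousAt.continuousWithinAt.congr_of_eventuallyEq ?_ (hFeq.self_of_nhds ht)
    exact eventually_nhdsWithin_iff.2 hFeq
  have hpd : ∀ t ∈ Set.Ioo (0 : ℝ) 1, HasDerivAt p (deriv p t) t := by
    intro t ht
    obtain ⟨F, hF, hFeq⟩ := hloc t (Set.Ioo_subset_Icc_self ht)
    refine (hF.congr_of_eventuallyEq ?_).hasDerivAt
    filter_upwards [hFeq, Icc_mem_nhds ht.1 ht.2] with s h1 h2 using h1 h2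
  have hvd : ∀ t ∈ Set.Ioo (0 : ℝ) 1, HasDerivAt (fun s => zetaVec (p s))
      ((2 * alpha (Zvec d)) • deriv p t) t := fun t ht =>
    ((hpd t ht).const_smul (2 * alpha (Zvec d))).sub_const _
  have hvc : ContinuousOn (fun s => zetaVec (p s)) (Set.Icc 0 1) :=
    (hpc.const_smul (2 * alpha (Zvec d))).sub continuousOn_const
  have key := h.arccos_metric_le (div_nonneg (alpha_Zvec_nonneg (d := d)) hsinh.le) hvc
    (fun t ht => zetaVec_isHermitian (topProj_isHermitian (h.mem t ht)))
    (fun t ht => metric_zetaVec_topProj (h.mem t ht)) hvd ?_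
  · simpa only [hp, h.source, h.target] using key
  intro t ht
  have ht' := Set.Ioo_subset_Icc_self ht
  have hmem : ∀ᶠ s in nhds t, γ s ∈ SymSpace d 𝕜 := by
    filter_upwards [Icc_mem_nhds ht.1 ht.2] with s hs using h.mem s hs
  have hQ : (deriv p t).IsHermitian :=
    SLSym.isHermitian_deriv (hmem.mono fun s hs => topProj_isHermitian hs) (hpd t ht)
  have hQP : deriv p t * topProj (γ t) + topProj (γ t) * deriv p t = deriv p t := by
    have h1 : HasDerivAt (fun s => p s * p s) (deriv p t * p t + p t * deriv p t) t :=
      (hpd t ht).mul (hpd t ht)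
    exact (h1.congr_of_eventuallyEq (hmem.mono fun s hs => (topProj_mul_self hs).symm)).unique
      (hpd t ht)
  have hder : deriv p t * γ t * topProj (γ t) = (1 - topProj (γ t)) * deriv γ t * topProj (γ t)
      + (1 - topProj (γ t)) * γ t * deriv p t := by
    have h1 : HasDerivAt (fun s => (1 - p s) * γ s * p s)
        ((-deriv p t * γ t + (1 - p t) * deriv γ t) * p t + (1 - p t) * γ t * deriv p t) t :=
      ((((hpd t ht).const_sub 1).mul (h.hasDerivAt t)).mul (hpd t ht))
    have h2 := h1.unique ((hasDerivAt_const t (0 : Mat d 𝕜)).congr_of_eventuallyEq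
      (hmem.mono fun s hs => one_sub_topProj_mul_mul hs))
    rw [Matrix.add_mul, Matrix.neg_mul, Matrix.neg_mul, add_assoc, neg_add_eq_zero] at h2
    exact h2
  have hle := metric_deriv_topProj_le (h.mem t ht') hS.le (hSγ t ht') (h.isHermitian_deriv ht) hQ
    hQP hder
  have hsq : metric 1 ((2 * alpha (Zvec d)) • deriv p t) ((2 * alpha (Zvec d)) • deriv p t)
      = alpha (Zvec d) ^ 2 * (4 * metric 1 (deriv p t) (deriv p t)) := by
    simp only [metric_one_eq, Matrix.smul_mul, Matrix.mul_smul, Matrix.trace_smul, RCLike.smul_re]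
    ring
  rw [hsq, mul_pow, div_pow, speed, Real.sq_sqrt (metric_self_nonneg (h.mem t ht')
    (h.isHermitian_deriv ht)), div_mul_eq_mul_div, mul_div_assoc]
  refine mul_le_mul_of_nonneg_left ?_ (sq_nonneg _)
  rw [le_div_iff₀ (by positivity)]
  linarith

theorem angle_act [d.AtLeastTwo] (g : Matrix.SpecialLinearGroup (Fin d) 𝕜) {x y : Mat d 𝕜}
    (hx : x ∈ regularSet 1) (hy : y ∈ regularSet 1) :
    angle (act g.1 1) (zeta (act g.1 1) (act g.1 x)) (zeta (act g.1 1) (act g.1 y))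
      = Real.arccos (metric 1 (zetaVec (topProj x)) (zetaVec (topProj y))) := by
  rw [angle, direction_zeta_act g hx, direction_zeta_act g hy, metric_act (isUnit_det_SL g)]

theorem angle_zeta_le [d.AtLeastTwo] {o : Mat d 𝕜} (ho : o ∈ SymSpace d 𝕜) {S D : ℝ}
    (hDS : D < S) {x y : Mat d 𝕜} (hx : x ∈ SymSpace d 𝕜) (hy : y ∈ SymSpace d 𝕜)
    (hS : S ≤ dAlpha o x) (hD : rdist x y ≤ D) :
    y ∈ regularSet o ∧ angle o (zeta o x) (zeta o y)
      ≤ alpha (Zvec d) / Real.sinh (S - D) * rdist x y := by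
  obtain ⟨g, rfl⟩ := exists_act_one_eq ho
  obtain ⟨x', rfl⟩ : ∃ x', x = act g.1 x' := ⟨_, (act_act_inv g x).symm⟩
  obtain ⟨y', rfl⟩ : ∃ y', y = act g.1 y' := ⟨_, (act_act_inv g y).symm⟩
  have hx' : x' ∈ SymSpace d 𝕜 := by
    have := act_mem_symSpace g⁻¹ hx
    rwa [act_inv_act] at this
  have hy' : y' ∈ SymSpace d 𝕜 := by
    have := act_mem_symSpace g⁻¹ hy
    rwa [act_inv_act] at this
  have hS' : S ≤ dAlpha 1 x' := by rwa [dAlpha, vecDist_act g hx'] at hS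
  -- Curves of almost minimal length stay in the region of large root pseudodistance.
  have main : ∀ ε ∈ Set.Ioo 0 (S - D), x' ∈ regularSet 1 ∧ y' ∈ regularSet 1 ∧
      Real.arccos (metric 1 (zetaVec (topProj x')) (zetaVec (topProj y')))
        ≤ alpha (Zvec d) / Real.sinh (S - D - ε) * (rdist (act g.1 x') (act g.1 y') + ε) := by
    rintro ε ⟨hε, hεS⟩
    obtain ⟨γ₀, hγ₀, hL₀⟩ := exists_isCurve_curveLength_lt hx hy (lt_add_of_pos_right _ hε)
    have hγ := hγ₀.act g⁻¹
    have hL := hγ₀.curveLength_act g⁻¹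
    rw [act_inv_act, act_inv_act] at hγ
    generalize (fun t => act (g⁻¹).1 (γ₀ t)) = γ at hγ hL
    rw [← hL] at hL₀
    have hSε : 0 < S - D - ε := by linarith
    have hall : ∀ t ∈ Set.Icc (0 : ℝ) 1, S - D - ε ≤ dAlpha 1 (γ t) := fun t ht => by
      have := hγ.dAlpha_sub_curveLength_le ht
      linarith
    have hx1 := hall 0 (by simp)
    have hy1 := hall 1 (by simp)
    rw [hγ.source] at hx1
    rw [hγ.target] at hy1
    refine ⟨⟨hx', by linarith⟩, ⟨hy', by linarith⟩, ?_⟩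
    refine (hγ.arccos_metric_zetaVec_le hSε hall).trans ?_
    exact mul_le_mul_of_nonneg_left hL₀.le
      (div_nonneg alpha_Zvec_nonneg (Real.sinh_nonneg_iff.2 hSε.le))
  obtain ⟨hxr, hyr, -⟩ := main ((S - D) / 2) ⟨by linarith, by linarith⟩
  refine ⟨(act_mem_regularSet_iff g hy').2 hyr, ?_⟩
  rw [angle_act g hxr hyr]
  have hsinh : Real.sinh (S - D - 0) ≠ 0 := by
    rw [sub_zero]
    exact (Real.sinh_pos_iff.2 (by linarith)).ne'
  have hlim : Filter.Tendsto (fun ε : ℝ => alpha (Zvec d) / Real.sinh (S - D - ε)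
        * (rdist (act g.1 x') (act g.1 y') + ε)) (nhdsWithin 0 (Set.Ioi 0))
      (nhds (alpha (Zvec d) / Real.sinh (S - D - 0)
        * (rdist (act g.1 x') (act g.1 y') + 0))) := by
    refine Filter.Tendsto.mono_left ?_ nhdsWithin_le_nhds
    have h1 : ContinuousAt (fun ε : ℝ => Real.sinh (S - D - ε)) 0 :=
      (Real.continuous_sinh.comp (continuous_const.sub continuous_id)).continuousAt
    exact (continuousAt_const.div h1 hsinh).mul (continuousAt_const.add continuousAt_id)
  rw [sub_zero, add_zero] at hlim
  refine ge_of_tendsto hlim ?_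
  filter_upwards [Ioo_mem_nhdsGT (sub_pos.2 hDS)] with ε hε using (main ε hε).2.2

end SLSym

end

open SLSym
theorem mainTheorem3 {𝕜 : Type*} [RCLike 𝕜] (d : ℕ) [d.AtLeastTwo]
    (o : Mat d 𝕜) (ho : o ∈ SymSpace d 𝕜) :
    (∀ x ∈ regularSet o, (∃! η, IsZetaPoint o x η) ∧ ∃! v, IsDirection o (zeta o x) v) ∧
    SmoothBetween (fun x => direction o (zeta o x)) (regularSet o) (orbitZ o) ∧
    ∀ S D : ℝ, 0 ≤ D → D < S → ∀ x ∈ SymSpace d 𝕜, ∀ y ∈ SymSpace d 𝕜,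
      S ≤ dAlpha o x → rdist x y ≤ D →
        y ∈ regularSet o ∧
        angle o (zeta o x) (zeta o y) ≤ alpha (Zvec d) / Real.sinh (S - D) * rdist x y := by
  refine ⟨fun x hx => ⟨existsUnique_isZetaPoint ho hx, ?_⟩, smoothBetween_direction ho,
    fun S D _ hDS x hx y hy hS hD => angle_zeta_le ho hDS hx hy hS hD⟩
  obtain ⟨-, k, hko, hkx⟩ := isVecDist_vecDist ho hx.1
  rw [zeta_eq_endpoint ho hx hko hkx]
  exact ⟨_, (isDirection_zetaRay_iff hko).2 rfl, fun v hv => (isDirection_zetaRay_iff hko).1 hv⟩
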